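/- All rings are associative with identity, modules are right modules, functors are additive, and a \emph{Noetherian algebra} is a ring that is an algebra over some commutative Noetherian ring and finitely generated as a module over it. For a ring $R$, let $\mathrm{Mod}\,R$ denote the category of right $R$-modules and $\mathrm{mod}\,R$ the full subcategory of finitely generated ones. A \emph{cleft extension} $(\mathscr B,\mathscr A,\mathsf i,\mathsf e,\mathsf l)$ of an abelian category $\mathscr B$ consists of an abelian category $\mathscr A$ and functors $\mathsf i:\mathscr B\to\mathscr A$, $\mathsf e:\mathscr A\to\mathscr B$, $\mathsf l:\mathscr B\to\mathscr A$ such that $\mathsf e$ is faithful and exact, $\mathsf l$ is left adjoint to $\mathsf e$, and $\mathsf e\mathsf i\cong \mathrm{Id}_{\mathscr B}$. If $\mu:\mathsf l\mathsf e\to \mathrm{Id}_{\mathscr A}$ is the counit, set $\mathsf G(X)=\ker(\mu_X)$; the induced endofunctor of $\mathscr B$ is $\mathsf F=\mathsf e\mathsf G\mathsf i$. It is \emph{left perfect} if (1) $\mathbb L_i(\mathsf F^j)(\mathsf F P)=0$ for every projective object $P$ and all $i,j\ge 1$, and (2) there is an integer $m\ge 0$ such that $\mathbb L_p(\mathsf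 F^q)=0$ for all $p,q\ge 1$ with $p+q\ge m+1$. Here $\mathbb L_p(\mathsf F^q)$ is the $p$-th left derived functor of the $q$-fold composition $\mathsf F^q$. For an object $T$ of a triangulated category $\mathscr T$, let $\langle T\rangle_1$ be the smallest full subcategory containing $T$ and closed under finite direct sums, direct summands and shifts, and let $\langle T\rangle_{k+1}$ ($k\ge 1$) be the closure under finite direct sums, direct summands and shifts of the class of objects $X$ admitting a triangle $U\to X\to V\to U[1]$ with $U\in\langle T\rangle_1$ and $V\in\langle T\rangle_k$. The \emph{Rouquier dimension} $\dim\mathscr T\in\mathbb N\cup\{\infty\}$ is the least $d\ge 0$ such that $\mathscr T=\langle T\rangle_{d+1}$ for some object $T$, or $\infty$ if there is no such $d$. \textbf{Theorem.} Let $A$ and $B$ be Noetherian algebras and let $(\mathrm{Mod}\,B,\mathrm{Mod}\,A,\mathsf i,\mathsf e,\mathsf l)$ be a cleft extension of module categories whose induced endofunctor $\mathsf F$ of $\mathrm{Mod}\,B$ is left perfect and satisfies $\mathsf F^n=0$ for a positive integer $n$. Then the bounded derived categories satisfy $$\dim \mathbf D^b(\mathrm{mod}\,B)\ \le\ \dim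 \mathbf D^b(\mathrm{mod}\,A)\ \le\ n\bigl(\dim \mathbf D^b(\mathrm{mod}\,B)+1\bigr)-1,$$ where the right-hand side is $\infty$ if $\dim \mathbf D^b(\mathrm{mod}\,B)=\infty$. -/

import Mathlib

open CategoryTheory CategoryTheory.Limits

universe w₁ w₂ v₁ v₂ u₁ u₂ u

/-! ### Cleft extensions of abelian categories -/

/-- A cleft extension of the abelian category `𝓑`: an abelian category `𝓐` with additive functors
`i : 𝓑 ⥤ 𝓐`, `e : 𝓐 ⥤ 𝓑`, `l : 𝓑 ⥤ 𝓐` such that `e` is faithful and exact, `l` is left adjoint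
to `e`, and `e ∘ i` is naturally isomorphic to the identity of `𝓑`. (The functor `l` is
additive because it is adjoint to an additive functor.) -/
structure CleftExtension (𝓑 : Type u₁) [Category.{v₁} 𝓑] [Abelian 𝓑]
    (𝓐 : Type u₂) [Category.{v₂} 𝓐] [Abelian 𝓐] where
  i : 𝓑 ⥤ 𝓐
  e : 𝓐 ⥤ 𝓑
  l : 𝓑 ⥤ 𝓐
  i_additive : i.Additive
  e_additive : e.Additive
  e_faithful : e.Faithful
  e_preservesFiniteLimits : PreservesFiniteLimits e
  e_preservesFiniteColimits : PreservesFiniteColimits e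
  adj : l ⊣ e
  iso : i ⋙ e ≅ 𝟭 𝓑

namespace CleftExtension

variable {𝓑 : Type u₁} [Category.{v₁} 𝓑] [Abelian 𝓑]
  {𝓐 : Type u₂} [Category.{v₂} 𝓐] [Abelian 𝓐] (c : CleftExtension 𝓑 𝓐)

/-- The endofunctor `X ↦ ker (μ_X : l (e X) ⟶ X)` of `𝓐`, where `μ` is the counit of `l ⊣ e`. -/
noncomputable def G : 𝓐 ⥤ 𝓐 where
  obj X := kernel (c.adj.counit.app X)
  map f := kernel.map _ _ (c.l.map (c.e.map f)) f (c.adj.counit.naturality f).symm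
  map_id X := by
    rw [← cancel_mono (kernel.ι _)]
    simp
  map_comp f g := by
    rw [← cancel_mono (kernel.ι _)]
    simp

/-- The endofunctor `X ↦ e (G (i X))` of `𝓑` induced by the cleft extension. -/
noncomputable def F : 𝓑 ⥤ 𝓑 := c.i ⋙ c.G ⋙ c.e

instance G_additive : c.G.Additive where
  map_add {X Y f g} := by
    have := c.e_additive
    have := c.adj.left_adjoint_additive
    let ι (Z : 𝓐) : c.G.obj Z ⟶ c.l.obj (c.e.obj Z) := kernel.ι (c.adj.counit.app Z)
    have hι (Z : 𝓐) : Mono (ι Z) := inferInstanceAs (Mono (kernel.ι (c.adj.counit.app Z)))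
    have h {Z W : 𝓐} (k : Z ⟶ W) : c.G.map k ≫ ι W = ι Z ≫ c.l.map (c.e.map k) :=
      kernel.lift_ι _ _ _
    rw [← cancel_mono (ι Y), Preadditive.add_comp, h, h, h, Functor.map_add, Functor.map_add,
      Preadditive.comp_add]

instance F_additive : c.F.Additive := by
  have := c.i_additive
  have := c.e_additive
  unfold F
  infer_instance

end CleftExtension

/-! ### Powers of an endofunctor, left perfect endofunctors -/

/-- The `n`-fold composition `Φⁿ` of an endofunctor `Φ`. -/
def endofunctorPow {𝓑 : Type u₁} [Category.{v₁} 𝓑] (Φ : 𝓑 ⥤ 𝓑) : ℕ → (𝓑 ⥤ 𝓑)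
  | 0 => 𝟭 𝓑
  | n + 1 => endofunctorPow Φ n ⋙ Φ

instance endofunctorPow_additive {𝓑 : Type u₁} [Category.{v₁} 𝓑] [Preadditive 𝓑]
    (Φ : 𝓑 ⥤ 𝓑) [Φ.Additive] (n : ℕ) : (endofunctorPow Φ n).Additive := by
  induction n with
  | zero => exact inferInstanceAs (𝟭 𝓑).Additive
  | succ n ih => exact inferInstanceAs (endofunctorPow Φ n ⋙ Φ).Additive

/-- An additive endofunctor `Φ` is left perfect if, where `𝕃ₚ(Φ^q)` denotes the `p`-th left derived
functor of the `q`-th power of `Φ`, one has `𝕃ᵢ(Φʲ)(Φ P) = 0` for all projective `P` and all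
`i, j ≥ 1`, and there is `n ≥ 0` such that `𝕃ₚ(Φ^q) = 0` for all `p, q ≥ 1` with
`p + q ≥ n + 1`. -/
structure IsLeftPerfect {𝓑 : Type u₁} [Category.{v₁} 𝓑] [Abelian 𝓑] [HasProjectiveResolutions 𝓑]
    (Φ : 𝓑 ⥤ 𝓑) [Φ.Additive] : Prop where
  isZero_leftDerived_projective : ∀ (P : 𝓑), Projective P → ∀ i j : ℕ, 1 ≤ i → 1 ≤ j →
    IsZero (((endofunctorPow Φ j).leftDerived i).obj (Φ.obj P))
  exists_bound : ∃ n : ℕ, ∀ p q : ℕ, 1 ≤ p → 1 ≤ q → n + 1 ≤ p + q →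
    ∀ X : 𝓑, IsZero (((endofunctorPow Φ q).leftDerived p).obj X)

/-! ### The Rouquier dimension of a triangulated category -/

/-- The Rouquier dimension of a triangulated category `𝓣`: the least `n` such that
`𝓣 = ⟨T⟩_{n + 1}` for some object `T`, or `∞` if there is none.
Here `⟨T⟩_{n + 1}` is `(ObjectProperty.singleton T).triangEnvelopeIter n`:
the objects obtained from `T` by shifts, finite direct sums, direct summands and at most
`n` extensions. -/
noncomputable def rouquierDim (𝓣 : Type u₁) [Category.{v₁} 𝓣] [HasZeroObject 𝓣] [HasShift 𝓣 ℤ]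
    [Preadditive 𝓣] [∀ n : ℤ, (shiftFunctor 𝓣 n).Additive] [Pretriangulated 𝓣] : ℕ∞ :=
  ⨅ (n : ℕ) (_ : ∃ T : 𝓣, (ObjectProperty.singleton T).triangEnvelopeIter n = ⊤), (n : ℕ∞)

/-! ### Noetherian algebras and their module categories -/

/-- A Noetherian algebra: a ring which is an algebra over some commutative Noetherian ring, and
finitely generated as a module over it. (Replacing the base ring by its image in `A`, one may
take it in the universe of `A`.) -/
class IsNoetherianAlgebra (A : Type u) [Ring A] : Prop where
  exists_base : ∃ (R : Type u) (_ : CommRing R) (_ : IsNoetherianRing R) (_ : Algebra R A),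
    Module.Finite R A

instance isNoetherianRing_mop_of_isNoetherianAlgebra (A : Type u) [Ring A]
    [IsNoetherianAlgebra A] : IsNoetherianRing Aᵐᵒᵖ := by
  obtain ⟨R, _, _, _, _⟩ := IsNoetherianAlgebra.exists_base (A := A)
  have : Module.Finite R Aᵐᵒᵖ := Module.Finite.equiv (MulOpposite.opLinearEquiv R (M := A))
  exact IsNoetherianRing.of_finite R Aᵐᵒᵖ

/-- The category `Mod A` of right modules over `A`. -/
abbrev RightModCat (A : Type u) [Ring A] := ModuleCat.{u} Aᵐᵒᵖ

/-- The category `mod A` of finitely generated right modules over `A`. -/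
abbrev FGRightModCat (A : Type u) [Ring A] := FGModuleCat.{u} Aᵐᵒᵖ

/-! Since `e` is exact it induces a triangulated functor `eb` on bounded derived categories.
Applying `i` termwise shows that `eb` is essentially surjective, which gives the lower bound.

For the upper bound, the unit identifies `e (l X)` naturally with `X ⊕ F X` as far as short exact
sequences of complexes are concerned: each degree splits. Hence for a complex `P` of projectives
there is a triangle `P ⟶ e (l P) ⟶ F P`. As some left derived functor of `F` vanishes identically,
`l P` stays bounded, and `eb` acquires a left adjoint `L` computed by `l P` (`exists_universal`,
`eb_isRightAdjoint`). The unit at `eb Y` is a section of the image of the counit `L (eb Y) ⟶ Y`, so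
the cocone of the counit becomes `F P` in the derived category of `𝓑`, where `P` resolves `eb Y`
(`exists_triangle_counit`).

If `eb Y` is represented by a complex `K` whose terms are acyclic for all powers of `F`, then `F P`
may be replaced by `F K`, whose terms are again of this kind by left perfectness
(`isPowAcyclic_map`). Passing to the cocone thus lowers by one the power of `F` killing the terms
(`IsNilpotent.exists_triangle`). After `n` steps nothing is left, so `Y` is built from `n` objects
in the image of `L`, each needing `d + 1` layers of `L T` when `T` generates in `d + 1` layers
(`IsNilpotent.triangEnvelopeIter`).

All this holds for abelian categories with enough projectives in `𝓑`. For Noetherian algebras,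
nilpotence of `F` forces `i`, `e` and `l` to preserve finite generation (`preservesFG`), and the
hypotheses pass to the restricted extension because the inclusion of finitely generated modules is
exact, faithful and preserves projectives (`IsLeftPerfect.of_faithful`). -/

/-! ### Left derived functors of right exact functors -/

section LeftDerived

variable {𝓑 : Type u₁} [Category.{v₁} 𝓑] [Abelian 𝓑]
  {𝓓 : Type u₂} [Category.{v₂} 𝓓] [Abelian 𝓓]

/-- If `A ⟶ B ⟶ C` is exact and `B ⟶ C` is an epimorphism, then `A ⟶ B ⟶ D` is exact for a
morphism `C ⟶ D` if and only if this morphism is a monomorphism. -/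
lemma exact_comp_iff_mono {A B C D : 𝓓} (f : A ⟶ B) (g : B ⟶ C) (h : C ⟶ D) (w : f ≫ g = 0)
    (hex : (ShortComplex.mk f g w).Exact) [Epi g] :
    (ShortComplex.mk f (g ≫ h) (by rw [← Category.assoc, w, zero_comp])).Exact ↔ Mono h := by
  constructor
  · intro hS
    rw [Preadditive.mono_iff_cancel_zero]
    intro T x hx
    obtain ⟨T', π, _, y, hy⟩ := surjective_up_to_refinements_of_epi g x
    obtain ⟨T'', π', _, z, hz⟩ := hS.exact_up_to_refinements y (by
      dsimp; rw [← Category.assoc, ← hy, Category.assoc, hx, comp_zero])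
    dsimp at hz
    rw [← cancel_epi π, ← cancel_epi π', hy, ← Category.assoc, hz, Category.assoc, w]
    simp
  · intro _
    rw [ShortComplex.exact_iff_exact_up_to_refinements] at hex ⊢
    intro T x hx
    refine hex x ?_
    rw [← cancel_mono h, zero_comp, Category.assoc]
    exact hx

lemma exact_mk_up_to_refinements {A B C : 𝓓} {f : A ⟶ B} {g : B ⟶ C} {w : f ≫ g = 0}
    (hex : (ShortComplex.mk f g w).Exact) {T : 𝓓} (x : T ⟶ B) (hx : x ≫ g = 0) :
    ∃ (T' : 𝓓) (π : T' ⟶ T) (_ : Epi π) (y : T' ⟶ A), π ≫ x = y ≫ f :=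
  hex.exact_up_to_refinements x hx

lemma exact_map_mk {A B C : 𝓑} {f : A ⟶ B} {g : B ⟶ C} {w : f ≫ g = 0}
    (hex : (ShortComplex.mk f g w).Exact) (hg : Epi g) (Φ : 𝓑 ⥤ 𝓓) [Φ.PreservesZeroMorphisms]
    [PreservesFiniteColimits Φ] :
    (ShortComplex.mk (Φ.map f) (Φ.map g) (by rw [← Φ.map_comp, w, Φ.map_zero])).Exact :=
  hex.map_of_epi_of_preservesCokernel Φ hg inferInstance

variable (Φ : 𝓑 ⥤ 𝓓) [Φ.Additive]

/-- The vanishing of a left derived functor in terms of a projective resolution. -/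
lemma CategoryTheory.ProjectiveResolution.isZero_leftDerived_iff [HasProjectiveResolutions 𝓑]
    {X : 𝓑} (P : ProjectiveResolution X) (n : ℕ) :
    IsZero ((Φ.leftDerived (n + 1)).obj X) ↔
      ((ShortComplex.mk _ _ (P.complex.d_comp_d (n + 2) (n + 1) n)).map Φ).Exact := by
  rw [(P.isoLeftDerivedObj Φ (n + 1)).isZero_iff]
  refine (HomologicalComplex.exactAt_iff_isZero_homology _ _).symm.trans ?_
  exact HomologicalComplex.exactAt_iff' _ (n + 2) (n + 1) n
    (by simp only [ChainComplex.prev]; rfl) (by simp)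

/-- The augmentation of a projective resolution. -/
noncomputable def CategoryTheory.ProjectiveResolution.aug {X : 𝓑} (P : ProjectiveResolution X) :
    P.complex.X 0 ⟶ X := P.π.f 0

instance CategoryTheory.ProjectiveResolution.epi_aug {X : 𝓑} (P : ProjectiveResolution X) :
    Epi P.aug :=
  inferInstanceAs (Epi (P.π.f 0))

lemma CategoryTheory.ProjectiveResolution.d_comp_aug {X : 𝓑} (P : ProjectiveResolution X) :
    P.complex.d 1 0 ≫ P.aug = 0 :=
  P.complex_d_comp_π_f_zero

lemma CategoryTheory.ProjectiveResolution.exact_aug {X : 𝓑} (P : ProjectiveResolution X) :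
    (ShortComplex.mk _ _ P.d_comp_aug).Exact :=
  ShortComplex.exact_of_g_is_cokernel (ShortComplex.mk _ _ P.d_comp_aug) P.isColimitCokernelCofork

/-- Construction of projective resolutions from exact sequences. -/
lemma exists_projectiveResolution_of_exact (K : ChainComplex 𝓑 ℕ) [∀ n, Projective (K.X n)]
    {X : 𝓑} (p : K.X 0 ⟶ X) (hp : Epi p) (w : K.d 1 0 ≫ p = 0)
    (ex₀ : (ShortComplex.mk _ _ w).Exact)
    (ex : ∀ n, (ShortComplex.mk _ _ (K.d_comp_d (n + 2) (n + 1) n)).Exact) :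
    ∃ R : ProjectiveResolution X, R.complex = K := by
  let π : K ⟶ (ChainComplex.single₀ 𝓑).obj X := (ChainComplex.toSingle₀Equiv K X).symm ⟨p, w⟩
  have : QuasiIso π := by
    refine ⟨fun n ↦ ?_⟩
    obtain _ | n := n
    · rw [ChainComplex.quasiIsoAt₀_iff, ShortComplex.quasiIso_iff_of_zeros' _ (K.shape _ _ (by simp))
        (HomologicalComplex.single_obj_d (ComplexShape.down ℕ) 0 X _ _)
        (HomologicalComplex.single_obj_d (ComplexShape.down ℕ) 0 X _ _)]
      refine (ShortComplex.exact_and_epi_g_iff_of_iso ?_).2 ⟨ex₀, hp⟩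
      refine ShortComplex.isoMk (Iso.refl _) (Iso.refl _) (Iso.refl _) ?_ ?_
      · exact (Category.id_comp _).trans (Category.comp_id _).symm
      · exact (Category.id_comp _).trans
          ((ChainComplex.toSingle₀Equiv_symm_apply_f_zero p w).symm.trans
            (Category.comp_id _).symm)
    · rw [quasiIsoAt_iff_exactAt' π (n + 1) (ChainComplex.exactAt_succ_single_obj _ _),
        HomologicalComplex.exactAt_iff' K (n + 2) (n + 1) n
          (by simp only [ChainComplex.prev]; rfl) (by simp)]
      exact ex n
  exact ⟨{ complex := K, projective := inferInstance, π := π }, rfl⟩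

/-- A short exact sequence `0 ⟶ K ⟶ P₀ ⟶ X ⟶ 0` with `P₀` projective and a projective resolution
of `K` give a projective resolution of `X`. -/
lemma exists_projectiveResolution_of_shortExact {S : ShortComplex 𝓑} (hS : S.ShortExact)
    [Projective S.X₂] (P : ProjectiveResolution S.X₁) :
    ∃ R : ProjectiveResolution S.X₃, R.complex =
      P.complex.augment (P.aug ≫ S.f) (by
        rw [← Category.assoc, P.d_comp_aug, zero_comp]) := by
  have := hS.epi_g
  have := hS.mono_f
  have : ∀ n, Projective ((P.complex.augment (P.aug ≫ S.f) (by
        rw [← Category.assoc, P.d_comp_aug, zero_comp])).X n) := by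
    rintro (_ | n)
    · exact inferInstanceAs (Projective S.X₂)
    · exact inferInstanceAs (Projective (P.complex.X n))
  have hw : (P.aug ≫ S.f) ≫ S.g = 0 := by simp
  have h₀ : (ShortComplex.mk _ _ hw).Exact := by
    rw [ShortComplex.exact_iff_exact_up_to_refinements]
    intro T x hx
    obtain ⟨y, hy⟩ := hS.exact.lift' x hx
    obtain ⟨T', π, _, z, hz⟩ := surjective_up_to_refinements_of_epi P.aug y
    exact ⟨T', π, inferInstance, z, by
      dsimp; rw [← hy, ← Category.assoc, hz, Category.assoc]⟩
  refine exists_projectiveResolution_of_exact _ (X := S.X₃) S.g hS.epi_g hw h₀ ?_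
  rintro (_ | n)
  · exact (exact_comp_iff_mono (P.complex.d 1 0) P.aug S.f _ P.exact_aug).2 hS.mono_f
  · exact P.exact_succ n

/-- Dimension shifting. -/
lemma isZero_leftDerived_shift_iff [HasProjectiveResolutions 𝓑] {S : ShortComplex 𝓑}
    (hS : S.ShortExact) [Projective S.X₂] (n : ℕ) : IsZero ((Φ.leftDerived (n + 2)).obj S.X₃) ↔
      IsZero ((Φ.leftDerived (n + 1)).obj S.X₁) := by
  let P := projectiveResolution S.X₁
  obtain ⟨R, hR⟩ := exists_projectiveResolution_of_shortExact hS P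
  rw [ProjectiveResolution.isZero_leftDerived_iff Φ R, hR,
    ProjectiveResolution.isZero_leftDerived_iff Φ P]
  rfl

/-- The first left derived functor of a right exact functor. -/
lemma isZero_leftDerived_one_iff [HasProjectiveResolutions 𝓑] [PreservesFiniteColimits Φ]
    {S : ShortComplex 𝓑} (hS : S.ShortExact) [Projective S.X₂] :
    IsZero ((Φ.leftDerived 1).obj S.X₃) ↔ Mono (Φ.map S.f) := by
  let P := projectiveResolution S.X₁
  obtain ⟨R, hR⟩ := exists_projectiveResolution_of_shortExact hS P
  rw [ProjectiveResolution.isZero_leftDerived_iff Φ R, hR]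
  -- By right exactness `Φ X₁` is the cokernel of `Φ P₁ ⟶ Φ P₀`, so exactness at `Φ P₀` of the
  -- spliced complex says that `Φ X₁ ⟶ Φ X₂` has no kernel.
  have h := P.exact_aug.map_of_epi_of_preservesCokernel Φ P.epi_aug inferInstance
  have : Epi ((ShortComplex.mk _ _ P.d_comp_aug).map Φ).g := inferInstanceAs (Epi (Φ.map P.aug))
  rw [← exact_comp_iff_mono _ _ (Φ.map S.f) _ h]
  refine ShortComplex.exact_iff_of_iso
    (ShortComplex.isoMk (Iso.refl _) (Iso.refl _) (Iso.refl _) ?_ ?_)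
  · exact (Category.id_comp _).trans (Category.comp_id _).symm
  · exact (Category.id_comp _).trans
      ((Φ.map_comp P.aug S.f).symm.trans (Category.comp_id _).symm)

/-- If the first left derived functor of the right exact functor `Φ` vanishes on `C`, then `Φ`
preserves the monomorphism of a short exact sequence `0 ⟶ A ⟶ B ⟶ C ⟶ 0`. -/
lemma mono_map_of_isZero_leftDerived_one [EnoughProjectives 𝓑] [PreservesFiniteColimits Φ]
    {S : ShortComplex 𝓑} (hS : S.ShortExact) (h : IsZero ((Φ.leftDerived 1).obj S.X₃)) :
    Mono (Φ.map S.f) := by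
  have := hS.mono_f
  have := hS.epi_g
  let p := Projective.π S.X₃
  let s : Projective.over S.X₃ ⟶ S.X₂ := Projective.factorThru p S.g
  have hs : s ≫ S.g = p := Projective.factorThru_comp _ _
  let ι := kernel.ι p
  have hι : ι ≫ p = 0 := kernel.condition p
  obtain ⟨φ, hφ⟩ := hS.exact.lift' (ι ≫ s) (by rw [Category.assoc, hs, hι])
  have hK : (ShortComplex.mk ι p hι).ShortExact :=
    { exact := ShortComplex.exact_of_f_is_kernel _ (kernelIsKernel p)
      mono_f := inferInstanceAs (Mono (kernel.ι p))
      epi_g := inferInstanceAs (Epi (Projective.π S.X₃)) }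
  have hm : Mono (Φ.map ι) := (isZero_leftDerived_one_iff Φ hK).1 h
  -- `S.X₂` is the pushout of `S.X₁` and the projective cover of `S.X₃` along `kernel p`; pushouts
  -- are preserved by `Φ`, and `Φ.map ι` is already known to be mono.
  let a : kernel p ⟶ S.X₁ ⊞ Projective.over S.X₃ := biprod.lift (-φ) ι
  let b : S.X₁ ⊞ Projective.over S.X₃ ⟶ S.X₂ := biprod.desc S.f s
  have hab : a ≫ b = 0 := by simp [a, b, hφ]
  have hb : Epi b := by
    rw [epi_iff_surjective_up_to_refinements]
    intro T x
    obtain ⟨T', π, _, y, hy⟩ := surjective_up_to_refinements_of_epi p (x ≫ S.g)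
    obtain ⟨z, hz⟩ := hS.exact.lift' (π ≫ x - y ≫ s) (by
      rw [Preadditive.sub_comp, Category.assoc, Category.assoc, hs, hy, sub_self])
    exact ⟨T', π, inferInstance, biprod.lift z y, by simp [b, hz]⟩
  have hex : (ShortComplex.mk a b hab).Exact := by
    rw [ShortComplex.exact_iff_exact_up_to_refinements]
    intro T x hx
    obtain ⟨x₁, x₂, rfl⟩ : ∃ x₁ x₂, x = biprod.lift x₁ x₂ :=
      ⟨x ≫ biprod.fst, x ≫ biprod.snd, by ext <;> simp⟩
    dsimp at x₁ x₂ hx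
    simp only [b, biprod.lift_desc] at hx
    have hx₂ : x₂ ≫ p = 0 := by
      have := congr($hx ≫ S.g)
      simpa [hs] using this
    refine ⟨T, 𝟙 T, inferInstance, kernel.lift p x₂ hx₂, ?_⟩
    have h₁ : x₁ = - kernel.lift p x₂ hx₂ ≫ φ := by
      rw [← cancel_mono S.f, Preadditive.neg_comp, Category.assoc, hφ, ← Category.assoc,
        kernel.lift_ι]
      exact eq_neg_of_add_eq_zero_left hx
    dsimp
    ext <;> simp [a, h₁, ι]
  have hΦ := exact_map_mk hex hb Φ
  rw [Preadditive.mono_iff_cancel_zero]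
  intro T x hx
  obtain ⟨T', π, _, k, hk⟩ := exact_mk_up_to_refinements hΦ (x ≫ Φ.map biprod.inl) (by
    rw [Category.assoc, ← Φ.map_comp, biprod.inl_desc, hx])
  have hk₀ : k = 0 := by
    have := congr($hk ≫ Φ.map biprod.snd)
    simp only [Category.assoc, ← Φ.map_comp, a, biprod.inl_snd, biprod.lift_snd,
      Functor.map_zero, comp_zero] at this
    rw [← cancel_mono (Φ.map ι), ← this, zero_comp]
  have := congr($hk ≫ Φ.map biprod.fst)
  rw [hk₀] at this
  simp only [Category.assoc, ← Φ.map_comp, biprod.inl_fst, zero_comp] at this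
  rw [Φ.map_id, Category.comp_id] at this
  rwa [← cancel_epi π, comp_zero]

/-- A short exact sequence has compatible projective presentations. -/
lemma exists_shortExact_syzygies [EnoughProjectives 𝓑] {S : ShortComplex 𝓑}
    (hS : S.ShortExact) :
    ∃ (K P : ShortComplex 𝓑) (ι : K ⟶ P) (π : P ⟶ S) (w₁ : ι.τ₁ ≫ π.τ₁ = 0)
      (w₂ : ι.τ₂ ≫ π.τ₂ = 0) (w₃ : ι.τ₃ ≫ π.τ₃ = 0),
      K.ShortExact ∧ Nonempty P.Splitting ∧
      Projective P.X₁ ∧ Projective P.X₂ ∧ Projective P.X₃ ∧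
      (ShortComplex.mk _ _ w₁).ShortExact ∧ (ShortComplex.mk _ _ w₂).ShortExact ∧
      (ShortComplex.mk _ _ w₃).ShortExact := by
  have := hS.mono_f
  have := hS.epi_g
  let p := Projective.π S.X₃
  let q := Projective.π S.X₁
  let s : Projective.over S.X₃ ⟶ S.X₂ := Projective.factorThru p S.g
  have hs : s ≫ S.g = p := Projective.factorThru_comp _ _
  -- Horseshoe construction: the middle presentation is the direct sum of the outer ones, and the
  -- kernels form the sequence `K`.
  let r : Projective.over S.X₁ ⊞ Projective.over S.X₃ ⟶ S.X₂ := biprod.desc (q ≫ S.f) s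
  have hr : Epi r := by
    rw [epi_iff_surjective_up_to_refinements]
    intro T x
    obtain ⟨T', π, _, y, hy⟩ := surjective_up_to_refinements_of_epi p (x ≫ S.g)
    obtain ⟨z, hz⟩ := hS.exact.lift' (π ≫ x - y ≫ s) (by
      rw [Preadditive.sub_comp, Category.assoc, Category.assoc, hs, hy, sub_self])
    obtain ⟨T'', π', _, z', hz'⟩ := surjective_up_to_refinements_of_epi q z
    exact ⟨T'', π' ≫ π, epi_comp _ _, biprod.lift z' (π' ≫ y), by
      simp [r, ← reassoc_of% hz', hz]⟩
  have w {X Y : 𝓑} (f : X ⟶ Y) [Epi f] :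
      (ShortComplex.mk _ _ (kernel.condition f)).ShortExact :=
    { exact := ShortComplex.exact_of_f_is_kernel _ (kernelIsKernel f)
      mono_f := inferInstance
      epi_g := inferInstance }
  let P : ShortComplex 𝓑 := ShortComplex.mk (biprod.inl : Projective.over S.X₁ ⟶ _)
    (biprod.snd : _ ⟶ Projective.over S.X₃) (by simp)
  let k₁ : kernel q ⟶ kernel r := kernel.map _ _ biprod.inl S.f (by simp [r])
  let k₂ : kernel r ⟶ kernel p := kernel.map _ _ biprod.snd S.g (by
    ext <;> simp [r, hs])
  have hk₁ : k₁ ≫ kernel.ι r = kernel.ι q ≫ biprod.inl := kernel.lift_ι _ _ _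
  have hk₂ : k₂ ≫ kernel.ι p = kernel.ι r ≫ biprod.snd := kernel.lift_ι _ _ _
  have hk : k₁ ≫ k₂ = 0 := by
    rw [← cancel_mono (kernel.ι p), Category.assoc, hk₂, reassoc_of% hk₁]
    simp
  refine ⟨ShortComplex.mk k₁ k₂ hk, P,
    { τ₁ := kernel.ι q, τ₂ := kernel.ι r, τ₃ := kernel.ι p, comm₁₂ := hk₁.symm,
      comm₂₃ := hk₂.symm },
    { τ₁ := q, τ₂ := r, τ₃ := p, comm₁₂ := by simp [P, r],
      comm₂₃ := by dsimp [P]; ext <;> simp [r, hs] },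
    kernel.condition _, kernel.condition _, kernel.condition _, ?_,
    ⟨ShortComplex.Splitting.ofHasBinaryBiproduct _ _⟩,
    inferInstanceAs (Projective (Projective.over _)),
    inferInstanceAs (Projective (Projective.over _ ⊞ Projective.over _)),
    inferInstanceAs (Projective (Projective.over _)), w q, w r, w p⟩
  have hmono : Mono k₁ := by
    have : Mono (k₁ ≫ kernel.ι r) := by rw [hk₁]; infer_instance
    exact mono_of_mono k₁ (kernel.ι r)
  have hepi : Epi k₂ := by
    rw [epi_iff_surjective_up_to_refinements]
    intro T x
    obtain ⟨y, hy⟩ := hS.exact.lift' (x ≫ kernel.ι p ≫ s) (by simp [hs])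
    obtain ⟨T', π, _, z, hz⟩ := surjective_up_to_refinements_of_epi q y
    refine ⟨T', π, inferInstance,
      kernel.lift r (biprod.lift (-z) (π ≫ x ≫ kernel.ι p)) ?_, ?_⟩
    · simp [r, ← reassoc_of% hz, hy]
    · rw [← cancel_mono (kernel.ι p)]
      simp [hk₂]
  refine { exact := ?_, mono_f := hmono, epi_g := hepi }
  rw [ShortComplex.exact_iff_exact_up_to_refinements]
  intro T x hx
  dsimp at x hx
  have h₂ : (x ≫ kernel.ι r) ≫ biprod.snd = 0 := by
    rw [Category.assoc, ← hk₂, reassoc_of% hx, zero_comp]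
  have h₁ : x ≫ kernel.ι r = ((x ≫ kernel.ι r) ≫ biprod.fst) ≫ biprod.inl := by
    ext
    · simp
    · simpa using h₂
  refine ⟨T, 𝟙 T, inferInstance, kernel.lift q ((x ≫ kernel.ι r) ≫ biprod.fst) ?_, ?_⟩
  · rw [← cancel_mono S.f, zero_comp]
    have : (x ≫ kernel.ι r) ≫ r = 0 := by simp
    rw [h₁] at this
    simpa [r] using this
  · dsimp
    rw [← cancel_mono (kernel.ι r), Category.id_comp]
    refine h₁.trans ?_
    rw [Category.assoc _ k₁, hk₁, kernel.lift_ι_assoc]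

/-- If `0 ⟶ A ⟶ B ⟶ C ⟶ 0` is exact, then `𝕃ₙ₊₁Φ(A) = 0` when `𝕃ₙ₊₁Φ(B) = 0` and
`𝕃ₙ₊₂Φ(C) = 0`. -/
lemma isZero_leftDerived_left [EnoughProjectives 𝓑] [PreservesFiniteColimits Φ]
    {S : ShortComplex 𝓑} (hS : S.ShortExact) (n : ℕ)
    (h₂ : IsZero ((Φ.leftDerived (n + 1)).obj S.X₂))
    (h₃ : IsZero ((Φ.leftDerived (n + 2)).obj S.X₃)) :
    IsZero ((Φ.leftDerived (n + 1)).obj S.X₁) := by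
  induction n generalizing S with
  | zero =>
    obtain ⟨K, P, ι, π, w₁, w₂, w₃, hK, ⟨σ⟩, hP₁, hP₂, hP₃, h₁', h₂', h₃'⟩ :=
      exists_shortExact_syzygies hS
    rw [isZero_leftDerived_shift_iff Φ h₃'] at h₃
    have := mono_map_of_isZero_leftDerived_one Φ hK h₃
    have := (isZero_leftDerived_one_iff Φ h₂').1 h₂
    rw [isZero_leftDerived_one_iff Φ h₁']
    dsimp at this ⊢
    -- The composite equals `Φ K₁ ⟶ Φ K₂ ⟶ Φ P₂`: the first map is mono by the hypothesis on `S.X₃`,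
    -- the second by that on `S.X₂`.
    have : Mono (Φ.map ι.τ₁ ≫ Φ.map P.f) := by
      rw [← Φ.map_comp, ι.comm₁₂, Φ.map_comp]
      infer_instance
    exact mono_of_mono _ (Φ.map P.f)
  | succ n ih =>
    obtain ⟨K, P, ι, π, w₁, w₂, w₃, hK, ⟨σ⟩, hP₁, hP₂, hP₃, h₁', h₂', h₃'⟩ :=
      exists_shortExact_syzygies hS
    rw [isZero_leftDerived_shift_iff Φ h₁']
    rw [isZero_leftDerived_shift_iff Φ h₂'] at h₂
    rw [isZero_leftDerived_shift_iff Φ h₃'] at h₃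
    exact ih (S := K) hK h₂ h₃

end LeftDerived

/-! ### Acyclic objects and exactness of complexes under right exact functors. -/

section Acyclic

variable {𝓑 : Type u₁} [Category.{v₁} 𝓑] [Abelian 𝓑]
  {𝓓 : Type u₂} [Category.{v₂} 𝓓] [Abelian 𝓓]

/-- The short complex `K.opcycles i ⟶ K.X j ⟶ K.opcycles j`. -/
noncomputable def opcyclesShortComplex (K : CochainComplex 𝓑 ℤ) (i j : ℤ) : ShortComplex 𝓑 :=
  ShortComplex.mk (K.fromOpcycles i j) (K.pOpcycles j) (by
    rw [← cancel_epi (K.pOpcycles i), K.p_fromOpcycles_assoc, K.d_pOpcycles, comp_zero])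

lemma exact_d_pOpcycles (K : CochainComplex 𝓑 ℤ) (i j : ℤ) (hij : i + 1 = j) :
    (ShortComplex.mk (K.d i j) (K.pOpcycles j) (K.d_pOpcycles _ _)).Exact :=
  ShortComplex.exact_of_g_is_cokernel _ (K.opcyclesIsCokernel i j (by simp [← hij]))

lemma exactAt_iff_exact (K : CochainComplex 𝓑 ℤ) (i j k : ℤ) (hij : i + 1 = j)
    (hjk : j + 1 = k) :
    K.ExactAt j ↔ (ShortComplex.mk _ _ (K.d_comp_d i j k)).Exact :=
  K.exactAt_iff' i j k (by simp [← hij]) (by simp [← hjk])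

/-- Exactness in degree `i` is exactly injectivity of `opcycles i ⟶ K.X j`. These sequences exhibit
opcycles as successive syzygies and drive every dimension shift below. -/
lemma opcyclesShortComplex_shortExact (K : CochainComplex 𝓑 ℤ) (i j : ℤ) (hij : i + 1 = j)
    (hi : K.ExactAt i) : (opcyclesShortComplex K i j).ShortExact := by
  have hm : Mono (K.fromOpcycles i j) := by
    rw [exactAt_iff_exact K (i - 1) i j (by simp) hij] at hi
    rw [← exact_comp_iff_mono _ _ _ _ (exact_d_pOpcycles K (i - 1) i (by simp))]
    simpa using hi
  refine { exact := ?_, mono_f := hm, epi_g := inferInstanceAs (Epi (K.pOpcycles j)) }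
  rw [ShortComplex.exact_iff_exact_up_to_refinements]
  intro T x hx
  obtain ⟨T', π, _, y, hy⟩ := exact_mk_up_to_refinements (exact_d_pOpcycles K i j hij) x hx
  refine ⟨T', π, inferInstance, y ≫ K.pOpcycles i, ?_⟩
  exact hy.trans (by rw [← K.p_fromOpcycles i j, ← Category.assoc]; rfl)

variable (Φ : 𝓑 ⥤ 𝓓) [Φ.Additive] [EnoughProjectives 𝓑]

lemma isZero_leftDerived_of_isZero (n : ℕ) {X : 𝓑} (hX : IsZero X) :
    IsZero ((Φ.leftDerived (n + 1)).obj X) := by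
  have := hX.projective
  exact Φ.isZero_leftDerived_obj_projective_succ n X

variable [PreservesFiniteColimits Φ]

/-- If `0 ⟶ A ⟶ B ⟶ C ⟶ 0` is exact, then `𝕃ₙ₊₁Φ(B) = 0` when `𝕃ₙ₊₁Φ(A) = 0` and
`𝕃ₙ₊₁Φ(C) = 0`. -/
lemma isZero_leftDerived_middle {S : ShortComplex 𝓑} (hS : S.ShortExact) (n : ℕ)
    (h₁ : IsZero ((Φ.leftDerived (n + 1)).obj S.X₁))
    (h₃ : IsZero ((Φ.leftDerived (n + 1)).obj S.X₃)) :
    IsZero ((Φ.leftDerived (n + 1)).obj S.X₂) := by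
  induction n generalizing S with
  | zero =>
    obtain ⟨K, P, ι, π, w₁, w₂, w₃, hK, ⟨σ⟩, hP₁, hP₂, hP₃, h₁', h₂', h₃'⟩ :=
      exists_shortExact_syzygies hS
    have m₁ : Mono (Φ.map ι.τ₁) := (isZero_leftDerived_one_iff Φ h₁').1 h₁
    have m₃ : Mono (Φ.map ι.τ₃) := (isZero_leftDerived_one_iff Φ h₃').1 h₃
    have m : Mono (Φ.map P.f) := by
      have := σ.isSplitMono_f
      infer_instance
    rw [isZero_leftDerived_one_iff Φ h₂']
    dsimp
    rw [Preadditive.mono_iff_cancel_zero]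
    intro T x hx
    -- Diagram chase in the map from `Φ K` to `Φ P`: an element killed by the middle map comes from
    -- `Φ K₁`, where the injections into `Φ P₁` and then `Φ P₂` make it zero.
    obtain ⟨T', π, _, y, hy⟩ := exact_mk_up_to_refinements (exact_map_mk hK.exact hK.epi_g Φ) x (by
      rw [← cancel_mono (Φ.map ι.τ₃), Category.assoc, ← Φ.map_comp, ← ι.comm₂₃, Φ.map_comp,
        reassoc_of% hx, zero_comp, zero_comp])
    have hy₀ : y = 0 := by
      rw [← cancel_mono (Φ.map ι.τ₁), ← cancel_mono (Φ.map P.f), Category.assoc, ← Φ.map_comp,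
        ι.comm₁₂, Φ.map_comp, ← reassoc_of% hy, hx, comp_zero, zero_comp, zero_comp]
    rw [← cancel_epi π, hy, hy₀, zero_comp, comp_zero]
  | succ n ih =>
    obtain ⟨K, P, ι, π, w₁, w₂, w₃, hK, ⟨σ⟩, hP₁, hP₂, hP₃, h₁', h₂', h₃'⟩ :=
      exists_shortExact_syzygies hS
    rw [isZero_leftDerived_shift_iff Φ h₁'] at h₁
    rw [isZero_leftDerived_shift_iff Φ h₂']
    rw [isZero_leftDerived_shift_iff Φ h₃'] at h₃
    exact ih (S := K) hK h₁ h₃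

lemma exactAt_map_of_isZero_leftDerived_one (K : CochainComplex 𝓑 ℤ) (i j : ℤ) (hij : i + 1 = j)
    (hi : K.ExactAt i) (h : IsZero ((Φ.leftDerived 1).obj (K.opcycles j))) :
    ((Φ.mapHomologicalComplex (.up ℤ)).obj K).ExactAt i := by
  rw [exactAt_iff_exact _ (i - 1) i j (by simp) hij]
  have hm : Mono (Φ.map (K.fromOpcycles i j)) :=
    mono_map_of_isZero_leftDerived_one Φ (opcyclesShortComplex_shortExact K i j hij hi) h
  have := (exact_comp_iff_mono _ _ _ _
    (exact_map_mk (exact_d_pOpcycles K (i - 1) i (by simp)) inferInstance Φ)).2 hm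
  simp only [← Φ.map_comp, K.p_fromOpcycles] at this
  exact this

/-- An object is acyclic for `Φ` if the higher left derived functors of `Φ` vanish on it. -/
def IsLeftAcyclic (Φ : 𝓑 ⥤ 𝓓) [Φ.Additive] (X : 𝓑) : Prop :=
  ∀ n : ℕ, IsZero ((Φ.leftDerived (n + 1)).obj X)

/-- A right exact functor preserves the acyclicity of bounded above complexes of acyclic
objects. -/
lemma acyclic_map_of_isLeftAcyclic (K : CochainComplex 𝓑 ℤ) (a : ℤ) [K.IsStrictlyLE a]
    (hK : K.Acyclic) (h : ∀ i, IsLeftAcyclic Φ (K.X i)) :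
    ((Φ.mapHomologicalComplex (.up ℤ)).obj K).Acyclic := by
  -- Descending induction on the degree, starting above `a` where the opcycles vanish.
  have key (m : ℕ) : ∀ i, a + 1 - m ≤ i → IsLeftAcyclic Φ (K.opcycles i) := by
    induction m with
    | zero =>
      intro i hi n
      refine isZero_leftDerived_of_isZero Φ n ?_
      have h₀ : IsZero (K.X i) := K.isZero_of_isStrictlyLE a i (by simp at hi; lia)
      rw [IsZero.iff_id_eq_zero, ← cancel_epi (K.pOpcycles i)]
      exact h₀.eq_of_src _ _
    | succ m ih =>
      intro i hi n
      exact isZero_leftDerived_left Φ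
        (opcyclesShortComplex_shortExact K i (i + 1) rfl (hK i)) n (h (i + 1) n)
        (ih (i + 1) (by push_cast at hi; lia) (n + 1))
  intro i
  exact exactAt_map_of_isZero_leftDerived_one Φ K i (i + 1) rfl (hK i)
    (key (a + 1 - (i + 1)).toNat (i + 1) (by lia) 0)

/-- If the higher left derived functors of `Φ` vanish in large degrees, then `Φ` preserves
the exactness in low degrees of complexes of projective objects. -/
lemma exactAt_map_of_projective (K : CochainComplex 𝓑 ℤ) [∀ i, Projective (K.X i)]
    (N : ℕ) (hN : ∀ (X : 𝓑), IsZero ((Φ.leftDerived (N + 1)).obj X)) (a : ℤ)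
    (ha : ∀ i < a, K.ExactAt i) (i : ℤ) (hi : i + N < a) :
    ((Φ.mapHomologicalComplex (.up ℤ)).obj K).ExactAt i := by
  -- Each of the `m` steps up the complex raises the derived degree by one, until it reaches `N +
  -- 1`; hence the loss of `N` degrees of exactness.
  have key (m n : ℕ) (j : ℤ) (hmn : n + m = N) (hj : j + m ≤ a) :
      IsZero ((Φ.leftDerived (n + 1)).obj (K.opcycles j)) := by
    induction m generalizing n j with
    | zero =>
      obtain rfl : n = N := by simpa using hmn
      exact hN _
    | succ m ih =>
      have hS := opcyclesShortComplex_shortExact K j (j + 1) rfl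
        (ha j (by push_cast at hj; lia))
      have : Projective (opcyclesShortComplex K j (j + 1)).X₂ :=
        inferInstanceAs (Projective (K.X (j + 1)))
      exact (isZero_leftDerived_shift_iff Φ hS n).1
        (ih (n + 1) (j + 1) (by lia) (by push_cast at hj; lia))
  exact exactAt_map_of_isZero_leftDerived_one Φ K i (i + 1) rfl (ha i (by lia))
    (key N 0 (i + 1) (by simp) (by lia))

end Acyclic

/-! ### Quasi-isomorphisms between complexes of acyclic objects. -/

section QuasiIso

variable {𝓑 : Type u₁} [Category.{v₁} 𝓑] [Abelian 𝓑]
  {𝓓 : Type u₂} [Category.{v₂} 𝓓] [Abelian 𝓓]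

lemma quasiIso_iff_acyclic_mappingCone {K L : CochainComplex 𝓑 ℤ} (f : K ⟶ L) :
    QuasiIso f ↔ (CochainComplex.mappingCone f).Acyclic := by
  rw [← HomotopyCategory.quotient_obj_mem_subcategoryAcyclic_iff_acyclic,
    ← HomologicalComplex.mem_quasiIso_iff, ← HomotopyCategory.quotient_map_mem_quasiIso_iff,
    HomotopyCategory.quasiIso_eq_trW_subcategoryAcyclic]
  exact ObjectProperty.trW_iff_of_distinguished _ _
    (HomotopyCategory.mappingCone_triangleh_distinguished f)

variable (Φ : 𝓑 ⥤ 𝓓) [Φ.Additive] [EnoughProjectives 𝓑] [PreservesFiniteColimits Φ]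

/-- A right exact functor preserves quasi-isomorphisms between bounded above complexes of acyclic
objects. -/
lemma quasiIso_map_of_isLeftAcyclic {K L : CochainComplex 𝓑 ℤ} (f : K ⟶ L) [QuasiIso f]
    (a : ℤ) [K.IsStrictlyLE a] [L.IsStrictlyLE a] (hK : ∀ i, IsLeftAcyclic Φ (K.X i))
    (hL : ∀ i, IsLeftAcyclic Φ (L.X i)) :
    QuasiIso ((Φ.mapHomologicalComplex (.up ℤ)).map f) := by
  have hf := (quasiIso_iff_acyclic_mappingCone f).1 inferInstance
  rw [quasiIso_iff_acyclic_mappingCone]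
  let e (i : ℤ) : (CochainComplex.mappingCone f).X i ≅ K.X (i + 1) ⊞ L.X i :=
    HomologicalComplex.homotopyCofiber.XIsoBiprod f i (i + 1) (by simp)
  have : (CochainComplex.mappingCone f).IsStrictlyLE a := by
    rw [CochainComplex.isStrictlyLE_iff]
    intro i hi
    refine IsZero.of_iso ?_ (e i)
    rw [biprod_isZero_iff]
    exact ⟨K.isZero_of_isStrictlyLE a _ (by lia), L.isZero_of_isStrictlyLE a _ hi⟩
  have h : ((Φ.mapHomologicalComplex (.up ℤ)).obj (CochainComplex.mappingCone f)).Acyclic := by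
    refine acyclic_map_of_isLeftAcyclic Φ _ a hf (fun i n ↦ ?_)
    refine IsZero.of_iso ?_ ((Φ.leftDerived (n + 1)).mapIso (e i))
    exact isZero_leftDerived_middle Φ
      (ShortComplex.Splitting.ofHasBinaryBiproduct (K.X (i + 1)) (L.X i)).shortExact n
      (hK _ n) (hL _ n)
  intro i
  exact (h i).of_iso (CochainComplex.mappingCone.mapHomologicalComplexIso f Φ)

end QuasiIso

/-! ### Projective resolutions of bounded above complexes. -/

section Resolutions

variable {𝓑 : Type u₁} [Category.{v₁} 𝓑] [Abelian 𝓑]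

open Opposite

lemma quasiIso_of_opEquivalence {K L : CochainComplex 𝓑 ℤ} (f : K ⟶ L)
    (hf : QuasiIso ((CochainComplex.opEquivalence 𝓑).functor.map f.op)) : QuasiIso f := by
  refine ⟨fun i ↦ ?_⟩
  obtain ⟨j, rfl⟩ : ∃ j, i = - j := ⟨-i, by simp⟩
  have h := hf.quasiIsoAt j
  rw [quasiIsoAt_iff' _ (j - 1) j (j + 1) (by simp) (by simp)] at h
  rw [quasiIsoAt_iff' _ (-(j + 1)) (-j) (-(j - 1)) (by simp; lia) (by simp; lia),
    ← ShortComplex.quasiIso_opMap_iff]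
  exact h

/-- Bounded above complexes have bounded above projective resolutions. -/
lemma exists_quasiIso_projective [EnoughProjectives 𝓑] (K : CochainComplex 𝓑 ℤ) (a : ℤ)
    [K.IsStrictlyLE a] :
    ∃ (P : CochainComplex 𝓑 ℤ) (f : P ⟶ K) (_ : QuasiIso f) (_ : ∀ i, Projective (P.X i)),
      P.IsStrictlyLE a := by
  -- Passing to opposites and negating degrees reduces to injective resolutions of bounded below
  -- complexes.
  let e := CochainComplex.opEquivalence 𝓑
  have : (e.functor.obj (op K)).IsStrictlyGE (-a) := by
    rw [CochainComplex.isStrictlyGE_iff]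
    intro i hi
    exact (K.isZero_of_isStrictlyLE a (-i) (by lia)).op
  obtain ⟨I, f, hf, hI, hI'⟩ :=
    CochainComplex.Plus.modelCategoryQuillen.exists_quasiIso_injective (e.functor.obj (op K)) (-a)
  let P : CochainComplex 𝓑 ℤ := (e.inverse.obj I).unop
  let g : op K ⟶ op P := e.unitIso.hom.app (op K) ≫ e.inverse.map f
  refine ⟨P, g.unop, ?_, ?_, ?_⟩
  · have h : QuasiIso (e.functor.map g) := by
      have : e.functor.map g = f ≫ e.counitInv.app I := by
        simp [g]
      rw [this]
      infer_instance
    exact quasiIso_of_opEquivalence g.unop h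
  · intro i
    have := hI (-i)
    exact inferInstanceAs (Projective (unop (I.X (-i))))
  · rw [CochainComplex.isStrictlyLE_iff]
    intro i hi
    exact (I.isZero_of_isStrictlyGE (-a) (-i) (by lia)).unop

end Resolutions

/-! ### Objects acyclic for all powers of a left perfect endofunctor. -/

section Good

variable {𝓑 : Type u₁} [Category.{v₁} 𝓑] [Abelian 𝓑]

/-- Right exact functors commute with opcycles. -/
noncomputable def mapOpcyclesIso {𝓓 : Type u₂} [Category.{v₂} 𝓓] [Abelian 𝓓] (Ψ : 𝓑 ⥤ 𝓓)
    [Ψ.Additive] [PreservesFiniteColimits Ψ] (K : CochainComplex 𝓑 ℤ) (i j : ℤ)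
    (hij : i + 1 = j) :
    HomologicalComplex.opcycles ((Ψ.mapHomologicalComplex (.up ℤ)).obj K) j ≅
      Ψ.obj (K.opcycles j) :=
  IsColimit.coconePointUniqueUpToIso
    (HomologicalComplex.opcyclesIsCokernel ((Ψ.mapHomologicalComplex (.up ℤ)).obj K) i j
      (by simp [← hij]))
    (CokernelCofork.mapIsColimit _ (K.opcyclesIsCokernel i j (by simp [← hij])) Ψ)

lemma isIso_homologyι_of_isStrictlyLE (K : CochainComplex 𝓑 ℤ) (a : ℤ) [K.IsStrictlyLE a] :
    IsIso (K.homologyι a) :=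
  K.isIso_homologyι a (a + 1) (by simp)
    ((K.isZero_of_isStrictlyLE a (a + 1) (by lia)).eq_of_tgt _ _)

lemma exactAt_iff_of_natIso {𝓓 : Type u₂} [Category.{v₂} 𝓓] [Abelian 𝓓] {Ψ Ψ' : 𝓑 ⥤ 𝓓}
    [Ψ.Additive] [Ψ'.Additive] (τ : Ψ ≅ Ψ') (K : CochainComplex 𝓑 ℤ) (i : ℤ) :
    ((Ψ.mapHomologicalComplex (.up ℤ)).obj K).ExactAt i ↔
      ((Ψ'.mapHomologicalComplex (.up ℤ)).obj K).ExactAt i := by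
  let e := (NatIso.mapHomologicalComplex τ (.up ℤ)).app K
  exact ⟨fun h ↦ h.of_iso e, fun h ↦ h.of_iso e.symm⟩

section

variable {𝓓 : Type u₂} [Category.{v₂} 𝓓] [Abelian 𝓓]
  (Ψ : 𝓑 ⥤ 𝓓) [Ψ.Additive] [PreservesFiniteColimits Ψ]

lemma exactAt_map_iff_mono (K : CochainComplex 𝓑 ℤ) (i j : ℤ) (hij : i + 1 = j) :
    ((Ψ.mapHomologicalComplex (.up ℤ)).obj K).ExactAt i ↔ Mono (Ψ.map (K.fromOpcycles i j)) := by
  rw [exactAt_iff_exact _ (i - 1) i j (by simp) hij]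
  have := (exact_comp_iff_mono _ _ (Ψ.map (K.fromOpcycles i j)) _
    (exact_map_mk (exact_d_pOpcycles K (i - 1) i (by simp)) inferInstance Ψ))
  rw [← this]
  simp only [← Ψ.map_comp, K.p_fromOpcycles]
  rfl

variable [EnoughProjectives 𝓑]

/-- The left derived functors computed by complexes of projective objects which are exact
in low degrees. -/
lemma isZero_leftDerived_opcycles_iff (K : CochainComplex 𝓑 ℤ) [∀ i, Projective (K.X i)]
    (n : ℕ) (a b : ℤ) (hK : ∀ i < a, K.ExactAt i) (hab : b + n + 1 = a) :
    IsZero ((Ψ.leftDerived (n + 1)).obj (K.opcycles a)) ↔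
      ((Ψ.mapHomologicalComplex (.up ℤ)).obj K).ExactAt b := by
  have : Projective (opcyclesShortComplex K (a - 1) a).X₂ := inferInstanceAs (Projective (K.X a))
  have hS := opcyclesShortComplex_shortExact K (a - 1) a (by simp) (hK (a - 1) (by lia))
  induction n generalizing a with
  | zero =>
    obtain rfl : b = a - 1 := by simp at hab; lia
    rw [exactAt_map_iff_mono Ψ K (a - 1) a (by simp)]
    exact isZero_leftDerived_one_iff Ψ hS
  | succ n ih =>
    refine (isZero_leftDerived_shift_iff Ψ hS n).trans ?_
    refine ih (a - 1) (fun i hi ↦ hK i (by lia)) (by push_cast at hab; lia)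
      (inferInstanceAs (Projective (K.X (a - 1)))) ?_
    exact opcyclesShortComplex_shortExact K _ _ (by simp) (hK _ (by lia))

end

variable [EnoughProjectives 𝓑]

/-- A complex in nonpositive degrees which is exact in negative degrees has a resolution by a
complex of projectives with the same properties, and the same zeroth cohomology. -/
lemma exists_projective_of_exactAt (K : CochainComplex 𝓑 ℤ) [K.IsStrictlyLE 0]
    (hK : ∀ i < 0, K.ExactAt i) :
    ∃ (P : CochainComplex 𝓑 ℤ) (f : P ⟶ K) (_ : QuasiIso f) (_ : ∀ i, Projective (P.X i)),
      P.IsStrictlyLE 0 ∧ (∀ i < 0, P.ExactAt i) ∧ Nonempty (P.opcycles 0 ≅ K.opcycles 0) := by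
  obtain ⟨P, f, hf, hP, hP'⟩ := exists_quasiIso_projective K 0
  refine ⟨P, f, hf, hP, hP', fun i hi ↦ ?_, ?_⟩
  · rw [← quasiIsoAt_iff_exactAt' f i (hK i hi)]
    infer_instance
  · have := isIso_homologyι_of_isStrictlyLE P 0
    have := isIso_homologyι_of_isStrictlyLE K 0
    exact ⟨(asIso (P.homologyι 0)).symm ≪≫ isoOfQuasiIsoAt f 0 ≪≫ asIso (K.homologyι 0)⟩

lemma exists_projective_complex (X : 𝓑) :
    ∃ (P : CochainComplex 𝓑 ℤ) (_ : ∀ i, Projective (P.X i)),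
      P.IsStrictlyLE 0 ∧ (∀ i < 0, P.ExactAt i) ∧ Nonempty (P.opcycles 0 ≅ X) := by
  let K := (CochainComplex.singleFunctor 𝓑 0).obj X
  obtain ⟨P, f, _, hP, h₁, h₂, ⟨e⟩⟩ := exists_projective_of_exactAt K
    (fun i hi ↦ HomologicalComplex.exactAt_single_obj _ _ _ _ (by lia))
  have := isIso_homologyι_of_isStrictlyLE K 0
  exact ⟨P, hP, h₁, h₂, ⟨e ≪≫ (asIso (K.homologyι 0)).symm ≪≫
    HomologicalComplex.singleObjHomologySelfIso _ _ _⟩⟩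

/-- Objects which are acyclic for all the powers of an endofunctor. -/
def IsPowAcyclic (Φ : 𝓑 ⥤ 𝓑) [Φ.Additive] (X : 𝓑) : Prop :=
  ∀ j : ℕ, IsLeftAcyclic (endofunctorPow Φ (j + 1)) X

variable (Φ : 𝓑 ⥤ 𝓑) [Φ.Additive]

lemma isPowAcyclic_of_projective (X : 𝓑) [Projective X] : IsPowAcyclic Φ X :=
  fun _ n ↦ Functor.isZero_leftDerived_obj_projective_succ _ n X

instance endofunctorPow_preservesFiniteColimits [PreservesFiniteColimits Φ] (n : ℕ) :
    PreservesFiniteColimits (endofunctorPow Φ n) := by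
  induction n with
  | zero => exact inferInstanceAs (PreservesFiniteColimits (𝟭 𝓑))
  | succ n ih => exact comp_preservesFiniteColimits _ _

/-- `Φⁿ⁺¹` is also the composition of `Φ` and `Φⁿ`. -/
noncomputable def endofunctorPowSuccIso (n : ℕ) :
    endofunctorPow Φ (n + 1) ≅ Φ ⋙ endofunctorPow Φ n :=
  match n with
  | 0 => Functor.leftUnitor _ ≪≫ (Functor.rightUnitor _).symm
  | n + 1 => Functor.isoWhiskerRight (endofunctorPowSuccIso n) Φ ≪≫ Functor.associator _ _ _

/-- Let `C` be a projective resolution of `X`. Then `Φ C` resolves `Φ X`, and its terms are acyclic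
for the powers of `Φ` by the first condition of left perfectness. So `Φ C` computes the derived
functors of `Φʲ⁺¹` at `Φ X`, and `Φʲ⁺¹ (Φ C) ≅ Φʲ⁺² C` is exact in negative degrees because `X` is
acyclic for `Φʲ⁺²`. -/
lemma isPowAcyclic_map [PreservesFiniteColimits Φ] (hperf : IsLeftPerfect Φ) (X : 𝓑)
    (hX : IsPowAcyclic Φ X) : IsPowAcyclic Φ (Φ.obj X) := by
  obtain ⟨C, hC, hC₀, hCe, ⟨e⟩⟩ := exists_projective_complex X
  have hC' (j n : ℕ) : (((endofunctorPow Φ (j + 1)).mapHomologicalComplex (.up ℤ)).obj C).ExactAt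
      (-(n : ℤ) - 1) := by
    rw [← isZero_leftDerived_opcycles_iff _ C n 0 _ hCe (by lia)]
    exact (hX j n).of_iso (((endofunctorPow Φ (j + 1)).leftDerived (n + 1)).mapIso e)
  let K : CochainComplex 𝓑 ℤ := (Φ.mapHomologicalComplex (.up ℤ)).obj C
  have : K.IsStrictlyLE 0 := inferInstance
  have hK : ∀ i < 0, K.ExactAt i := by
    intro i hi
    obtain ⟨n, rfl⟩ : ∃ n : ℕ, i = -(n : ℤ) - 1 := ⟨(-i - 1).toNat, by lia⟩
    exact (exactAt_iff_of_natIso (Functor.leftUnitor Φ) C _).1 (hC' 0 n)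
  obtain ⟨P, f, _, hP, hP₀, hPe, ⟨e'⟩⟩ := exists_projective_of_exactAt K hK
  let e'' : P.opcycles 0 ≅ Φ.obj X := e' ≪≫ mapOpcyclesIso Φ C (-1) 0 (by simp) ≪≫ Φ.mapIso e
  intro j n
  refine IsZero.of_iso ?_ (((endofunctorPow Φ (j + 1)).leftDerived (n + 1)).mapIso e''.symm)
  refine (isZero_leftDerived_opcycles_iff _ P n 0 (-(n : ℤ) - 1) hPe (by lia)).2 ?_
  have := quasiIso_map_of_isLeftAcyclic (endofunctorPow Φ (j + 1)) f 0
    (fun i n ↦ isPowAcyclic_of_projective Φ (P.X i) j n)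
    (fun i n ↦ hperf.isZero_leftDerived_projective (C.X i) (hC i) (n + 1) (j + 1)
      (by simp) (by simp))
  rw [exactAt_iff_of_quasiIsoAt (((endofunctorPow Φ (j + 1)).mapHomologicalComplex (.up ℤ)).map f)]
  exact (exactAt_iff_of_natIso (endofunctorPowSuccIso Φ (j + 1)) C _).1 (hC' (j + 1) n)

end Good

/-! ### The natural splitting of `e (l X)` into `X` and `F X`. -/

namespace CleftExtension

variable {𝓑 : Type u₁} [Category.{v₁} 𝓑] [Abelian 𝓑]
  {𝓐 : Type u₂} [Category.{v₂} 𝓐] [Abelian 𝓐] (c : CleftExtension 𝓑 𝓐)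

attribute [instance] i_additive e_additive e_faithful e_preservesFiniteLimits
  e_preservesFiniteColimits

instance l_additive : c.l.Additive := c.adj.left_adjoint_additive

instance l_isLeftAdjoint : c.l.IsLeftAdjoint := c.adj.isLeftAdjoint

/-- The inclusion of `G X` in `l (e X)`. -/
noncomputable def Gι (X : 𝓐) : c.G.obj X ⟶ c.l.obj (c.e.obj X) := kernel.ι (c.adj.counit.app X)

@[simp]
lemma Gι_counit (X : 𝓐) : c.Gι X ≫ c.adj.counit.app X = 0 := kernel.condition _

instance (X : 𝓐) : Mono (c.Gι X) := inferInstanceAs (Mono (kernel.ι _))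

lemma Gι_naturality {X Y : 𝓐} (f : X ⟶ Y) :
    c.G.map f ≫ c.Gι Y = c.Gι X ≫ c.l.map (c.e.map f) := kernel.lift_ι _ _ _

/-- The triangle identity splits the counit after `e`, and the faithful functor `e` reflects
epimorphisms. -/
instance epi_counit (X : 𝓐) : Epi (c.adj.counit.app X) := by
  have : Epi (c.e.map (c.adj.counit.app X)) :=
    epi_of_epi_fac (c.adj.right_triangle_components X)
  exact c.e.epi_of_epi_map this

lemma shortExact_counit (X : 𝓐) :
    (ShortComplex.mk (c.Gι X) (c.adj.counit.app X) (c.Gι_counit X)).ShortExact where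
  exact := ShortComplex.exact_of_f_is_kernel _ (kernelIsKernel _)
  mono_f := inferInstanceAs (Mono (c.Gι X))
  epi_g := c.epi_counit X

/-- The isomorphism `e (i X) ≅ X`. -/
noncomputable def isoApp (X : 𝓑) : c.e.obj (c.i.obj X) ≅ X := c.iso.app X

lemma isoApp_hom_naturality {X Y : 𝓑} (f : X ⟶ Y) :
    c.e.map (c.i.map f) ≫ (c.isoApp Y).hom = (c.isoApp X).hom ≫ f := c.iso.hom.naturality f

lemma counit_naturality {X Y : 𝓐} (f : X ⟶ Y) :
    c.l.map (c.e.map f) ≫ c.adj.counit.app Y = c.adj.counit.app X ≫ f :=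
  c.adj.counit.naturality f

/-- The unit of the adjunction. -/
noncomputable def η (X : 𝓑) : X ⟶ c.e.obj (c.l.obj X) := c.adj.unit.app X

lemma η_naturality {X Y : 𝓑} (f : X ⟶ Y) :
    f ≫ c.η Y = c.η X ≫ c.e.map (c.l.map f) := c.adj.unit.naturality f

lemma η_counit (X : 𝓐) : c.η (c.e.obj X) ≫ c.e.map (c.adj.counit.app X) = 𝟙 _ :=
  c.adj.right_triangle_components X

/-- The retraction of the unit `X ⟶ e (l X)`. -/
noncomputable def ρ (X : 𝓑) : c.e.obj (c.l.obj X) ⟶ X :=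
  c.e.map (c.l.map (c.isoApp X).inv) ≫ c.e.map (c.adj.counit.app (c.i.obj X)) ≫ (c.isoApp X).hom

lemma map_isoApp_hom_ρ (X : 𝓑) :
    c.e.map (c.l.map (c.isoApp X).hom) ≫ c.ρ X =
      c.e.map (c.adj.counit.app (c.i.obj X)) ≫ (c.isoApp X).hom := by
  rw [ρ, ← Functor.map_comp_assoc, ← c.l.map_comp, Iso.hom_inv_id]
  simp

lemma ρ_naturality {X Y : 𝓑} (f : X ⟶ Y) : c.e.map (c.l.map f) ≫ c.ρ Y = c.ρ X ≫ f := by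
  rw [← cancel_epi (c.e.map (c.l.map (c.isoApp X).hom)), reassoc_of% c.map_isoApp_hom_ρ,
    ← c.isoApp_hom_naturality, ← Functor.map_comp_assoc, ← Functor.map_comp_assoc,
    ← c.l.map_comp, ← c.isoApp_hom_naturality]
  erw [← c.counit_naturality (c.i.map f)]
  rw [c.l.map_comp, Functor.map_comp_assoc, map_isoApp_hom_ρ, Functor.map_comp_assoc]

/-- The inclusion of `F X` in `e (l X)`. -/
noncomputable def κ (X : 𝓑) : c.F.obj X ⟶ c.e.obj (c.l.obj X) :=
  c.e.map (c.Gι (c.i.obj X)) ≫ c.e.map (c.l.map (c.isoApp X).hom)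

lemma κ_naturality {X Y : 𝓑} (f : X ⟶ Y) :
    c.F.map f ≫ c.κ Y = c.κ X ≫ c.e.map (c.l.map f) := by
  have h : c.e.map (c.G.map (c.i.map f)) ≫ c.e.map (c.Gι (c.i.obj Y)) ≫
      c.e.map (c.l.map (c.isoApp Y).hom) = (c.e.map (c.Gι (c.i.obj X)) ≫
      c.e.map (c.l.map (c.isoApp X).hom)) ≫ c.e.map (c.l.map f) := by
    rw [Category.assoc, ← Functor.map_comp, ← Functor.map_comp, ← Functor.map_comp,
      ← Functor.map_comp, ← c.l.map_comp, ← c.isoApp_hom_naturality, c.l.map_comp,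
      ← Category.assoc, c.Gι_naturality, Category.assoc]
  exact h

@[simp]
lemma κ_ρ (X : 𝓑) : c.κ X ≫ c.ρ X = 0 := by
  have h : (c.e.map (c.Gι (c.i.obj X)) ≫ c.e.map (c.l.map (c.isoApp X).hom)) ≫ c.ρ X = 0 := by
    rw [Category.assoc, map_isoApp_hom_ρ, ← Category.assoc, ← c.e.map_comp]
    erw [c.Gι_counit]
    simp
  exact h

@[simp]
lemma η_ρ (X : 𝓑) : c.η X ≫ c.ρ X = 𝟙 X := by
  rw [← cancel_epi (c.isoApp X).hom, reassoc_of% c.η_naturality, map_isoApp_hom_ρ,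
    reassoc_of% c.η_counit]
  simp

/-- This is the image under the exact functor `e` of the counit sequence at `i X`, transported along
`e (i X) ≅ X`. -/
lemma shortExact_κ_ρ (X : 𝓑) :
    (ShortComplex.mk (c.κ X) (c.ρ X) (c.κ_ρ X)).ShortExact := by
  have h := (c.shortExact_counit (c.i.obj X)).map_of_exact c.e
  let e₂ : c.e.obj (c.l.obj (c.e.obj (c.i.obj X))) ≅ c.e.obj (c.l.obj X) :=
    c.e.mapIso (c.l.mapIso (c.isoApp X))
  let e₃ : c.e.obj (c.i.obj X) ≅ X := c.isoApp X
  refine ShortComplex.shortExact_of_iso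
    (S₁ := .map (.mk _ _ (c.Gι_counit (c.i.obj X))) c.e) (S₂ := .mk (c.κ X) (c.ρ X) (c.κ_ρ X))
    (ShortComplex.isoMk (Iso.refl _) e₂ e₃ ?_ ?_) h
  · exact Category.id_comp _
  · exact c.map_isoApp_hom_ρ X

instance (X : 𝓑) : Mono (c.κ X) := (c.shortExact_κ_ρ X).mono_f

lemma exists_retraction (X : 𝓑) :
    ∃ s : c.e.obj (c.l.obj X) ⟶ c.F.obj X, s ≫ c.κ X = 𝟙 _ - c.ρ X ≫ c.η X := by
  let S := ShortComplex.Splitting.ofExactOfSection _ (c.shortExact_κ_ρ X).exact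
    (c.η X) (c.η_ρ X) (c.shortExact_κ_ρ X).mono_f
  exact ⟨S.r, S.r_f⟩

/-- The projection of `e (l X)` to `F X`. -/
noncomputable def σ (X : 𝓑) : c.e.obj (c.l.obj X) ⟶ c.F.obj X := (c.exists_retraction X).choose

lemma σ_κ (X : 𝓑) : c.σ X ≫ c.κ X = 𝟙 _ - c.ρ X ≫ c.η X := (c.exists_retraction X).choose_spec

lemma σ_naturality {X Y : 𝓑} (f : X ⟶ Y) :
    c.e.map (c.l.map f) ≫ c.σ Y = c.σ X ≫ c.F.map f := by
  rw [← cancel_mono (c.κ Y), Category.assoc, Category.assoc, κ_naturality, σ_κ,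
    reassoc_of% c.σ_κ X, Preadditive.comp_sub, Preadditive.sub_comp, Category.assoc,
    ← η_naturality, reassoc_of% c.ρ_naturality]
  simp

@[simp]
lemma κ_σ (X : 𝓑) : c.κ X ≫ c.σ X = 𝟙 _ := by
  rw [← cancel_mono (c.κ X), Category.assoc, σ_κ, Preadditive.comp_sub, reassoc_of% c.κ_ρ]
  simp

@[simp]
lemma η_σ (X : 𝓑) : c.η X ≫ c.σ X = 0 := by
  rw [← cancel_mono (c.κ X), Category.assoc, σ_κ, Preadditive.comp_sub, reassoc_of% c.η_ρ]
  simp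

/-- The splitting of `X ⟶ e (l X) ⟶ F X`. -/
noncomputable def splitting (X : 𝓑) :
    (ShortComplex.mk (c.η X) (c.σ X) (c.η_σ X)).Splitting where
  r := c.ρ X
  s := c.κ X
  f_r := c.η_ρ X
  s_g := c.κ_σ X
  id := by simp [σ_κ]

instance epi_σ (X : 𝓑) : Epi (c.σ X) := (c.splitting X).epi_g

/-- Through the natural maps `κ` and `σ`, `F` is a direct summand of `l ⋙ e`, which is right exact
as a left adjoint followed by an exact functor. -/
instance F_preservesFiniteColimits : PreservesFiniteColimits c.F := by
  have : PreservesFiniteColimits (c.l ⋙ c.e) := comp_preservesFiniteColimits _ _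
  refine (c.F.preservesFiniteColimits_iff_forall_exact_map_and_epi).2 fun S hS ↦ ?_
  obtain ⟨h₁, h₂⟩ := (Functor.preservesFiniteColimits_iff_forall_exact_map_and_epi
    (c.l ⋙ c.e)).1 inferInstance S hS
  constructor
  · have h₁' : (ShortComplex.mk (c.e.map (c.l.map S.f)) (c.e.map (c.l.map S.g))
        (by simp [← Functor.map_comp])).Exact := h₁
    refine (ShortComplex.exact_iff_exact_up_to_refinements _).2 fun A (x : A ⟶ c.F.obj S.X₂) hx ↦ ?_
    obtain ⟨A', π, hπ, y, hy⟩ := exact_mk_up_to_refinements h₁' (x ≫ c.κ S.X₂) (by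
      rw [Category.assoc, ← κ_naturality]
      exact (Category.assoc _ _ _).symm.trans ((congrArg (· ≫ c.κ S.X₃) hx).trans zero_comp))
    refine ⟨A', π, hπ, y ≫ c.σ S.X₁, ?_⟩
    have h := congrArg (· ≫ c.σ S.X₂) hy
    simp only [Category.assoc, κ_σ, Category.comp_id, σ_naturality] at h
    exact h.trans (Category.assoc _ _ _).symm
  · have : Epi (c.σ S.X₂ ≫ c.F.map S.g) := by
      rw [← σ_naturality]
      have : Epi (c.e.map (c.l.map S.g)) := h₂
      exact epi_comp _ _
    exact epi_of_epi (c.σ S.X₂) _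

end CleftExtension

/-- The functor on cochain complexes induced by an additive functor. -/
noncomputable abbrev mapCochain {𝓒 : Type u₁} [Category.{v₁} 𝓒] [Preadditive 𝓒]
    {𝓓 : Type u₂} [Category.{v₂} 𝓓] [Preadditive 𝓓] (Φ : 𝓒 ⥤ 𝓓) [Φ.Additive] :
    CochainComplex 𝓒 ℤ ⥤ CochainComplex 𝓓 ℤ :=
  Φ.mapHomologicalComplex (.up ℤ)

/-! ### Morphisms out of K-projective complexes in the derived category. -/

section KProjective

open DerivedCategory

variable {𝓒 : Type u₁} [Category.{v₁} 𝓒] [Abelian 𝓒] [HasDerivedCategory.{w₁} 𝓒]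

lemma Q_map_surjective_of_isKProjective (K L : CochainComplex 𝓒 ℤ) [K.IsKProjective] :
    Function.Surjective (Q.map : (K ⟶ L) → _) := by
  intro f
  obtain ⟨g, hg⟩ := (CochainComplex.IsKProjective.Qh_map_bijective K
    ((HomotopyCategory.quotient _ _).obj L)).surjective
      ((quotientCompQhIso 𝓒).hom.app K ≫ f ≫ (quotientCompQhIso 𝓒).inv.app L)
  obtain ⟨g, rfl⟩ := (HomotopyCategory.quotient _ _).map_surjective g
  refine ⟨g, ?_⟩
  rw [← cancel_epi ((quotientCompQhIso 𝓒).hom.app K), ← quotientCompQhIso_hom_naturality, hg]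
  simp

lemma nonempty_homotopy_of_isKProjective {K L : CochainComplex 𝓒 ℤ} [K.IsKProjective]
    (f g : K ⟶ L) (h : Q.map f = Q.map g) : Nonempty (Homotopy f g) := by
  refine ⟨HomotopyCategory.homotopyOfEq _ _
    ((CochainComplex.IsKProjective.Qh_map_bijective K _).injective ?_)⟩
  rw [← cancel_mono ((quotientCompQhIso 𝓒).hom.app L), quotientCompQhIso_hom_naturality,
    quotientCompQhIso_hom_naturality, h]

lemma Q_map_eq_of_homotopy {K L : CochainComplex 𝓒 ℤ} {f g : K ⟶ L} (h : Homotopy f g) :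
    Q.map f = Q.map g := by
  rw [← cancel_epi ((quotientCompQhIso 𝓒).hom.app K), ← quotientCompQhIso_hom_naturality,
    ← quotientCompQhIso_hom_naturality, HomotopyCategory.eq_of_homotopy _ _ h]

end KProjective

/-! ### The adjunction on complexes and on derived categories. -/

namespace CleftExtension

variable {𝓑 : Type u₁} [Category.{v₁} 𝓑] [Abelian 𝓑]
  {𝓐 : Type u₂} [Category.{v₂} 𝓐] [Abelian 𝓐] (c : CleftExtension 𝓑 𝓐)

/-- The unit on complexes. -/
noncomputable def ηC (K : CochainComplex 𝓑 ℤ) :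
    K ⟶ (mapCochain c.e).obj ((mapCochain c.l).obj K) where
  f i := c.η (K.X i)
  comm' i j _ := (c.η_naturality (K.d i j)).symm

/-- The counit on complexes. -/
noncomputable def counitC (K : CochainComplex 𝓐 ℤ) :
    (mapCochain c.l).obj ((mapCochain c.e).obj K) ⟶ K where
  f i := c.adj.counit.app (K.X i)
  comm' i j _ := (c.counit_naturality (K.d i j)).symm

/-- The projection of `e (l K)` to `F K`. -/
noncomputable def σC (K : CochainComplex 𝓑 ℤ) :
    (mapCochain c.e).obj ((mapCochain c.l).obj K) ⟶ (mapCochain c.F).obj K where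
  f i := c.σ (K.X i)
  comm' i j _ := (c.σ_naturality (K.d i j)).symm

lemma ηC_σC (K : CochainComplex 𝓑 ℤ) : c.ηC K ≫ c.σC K = 0 := by
  ext i
  exact c.η_σ _

lemma shortExact_ηC_σC (K : CochainComplex 𝓑 ℤ) :
    (ShortComplex.mk _ _ (c.ηC_σC K)).ShortExact :=
  HomologicalComplex.shortExact_of_degreewise_shortExact _ fun i ↦
    (c.splitting (K.X i)).shortExact

lemma ηC_naturality {K L : CochainComplex 𝓑 ℤ} (f : K ⟶ L) :
    f ≫ c.ηC L = c.ηC K ≫ (mapCochain c.e).map ((mapCochain c.l).map f) := by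
  ext i
  exact c.η_naturality _

lemma counitC_naturality {K L : CochainComplex 𝓐 ℤ} (f : K ⟶ L) :
    (mapCochain c.l).map ((mapCochain c.e).map f) ≫ c.counitC L = c.counitC K ≫ f := by
  ext i
  exact c.counit_naturality _

lemma ηC_counitC (K : CochainComplex 𝓐 ℤ) :
    c.ηC ((mapCochain c.e).obj K) ≫ (mapCochain c.e).map (c.counitC K) = 𝟙 _ := by
  ext i
  exact c.adj.right_triangle_components _

lemma map_ηC_counitC (K : CochainComplex 𝓑 ℤ) :
    (mapCochain c.l).map (c.ηC K) ≫ c.counitC ((mapCochain c.l).obj K) = 𝟙 _ := by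
  ext i
  exact c.adj.left_triangle_components _

lemma exactAt_iff_map_e (K : CochainComplex 𝓐 ℤ) (i : ℤ) :
    ((mapCochain c.e).obj K).ExactAt i ↔ K.ExactAt i :=
  ShortComplex.exact_map_iff_of_faithful (K.sc i) c.e

lemma projective_l (X : 𝓑) [Projective X] : Projective (c.l.obj X) :=
  c.adj.map_projective X inferInstance

/-- Exactness may be tested after `e`, where the long exact sequence of `K ⟶ e (l K) ⟶ F K` applies.
-/
lemma exactAt_map_l (K : CochainComplex 𝓑 ℤ) (i : ℤ) (h₁ : K.ExactAt i)
    (h₂ : ((mapCochain c.F).obj K).ExactAt i) : ((mapCochain c.l).obj K).ExactAt i := by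
  rw [← c.exactAt_iff_map_e, HomologicalComplex.exactAt_iff_isZero_homology]
  rw [HomologicalComplex.exactAt_iff_isZero_homology] at h₁ h₂
  exact (ShortComplex.ShortExact.homology_exact₂ (c.shortExact_ηC_σC K) i).isZero_X₂
    (IsZero.eq_of_src h₁ _ _) (IsZero.eq_of_tgt h₂ _ _)

section Derived

open DerivedCategory

variable [HasDerivedCategory.{w₁} 𝓑] [HasDerivedCategory.{w₂} 𝓐]

/-- The functor induced by `e` on derived categories. -/
noncomputable abbrev E : DerivedCategory 𝓐 ⥤ DerivedCategory 𝓑 := c.e.mapDerivedCategory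

/-- The functor induced by `e` on derived categories is computed termwise. -/
noncomputable def EQIso (K : CochainComplex 𝓐 ℤ) :
    c.E.obj (Q.obj K) ≅ Q.obj ((mapCochain c.e).obj K) :=
  c.e.mapDerivedCategoryFactors.app K

lemma EQIso_naturality {K L : CochainComplex 𝓐 ℤ} (f : K ⟶ L) :
    c.E.map (Q.map f) ≫ (c.EQIso L).hom = (c.EQIso K).hom ≫ Q.map ((mapCochain c.e).map f) :=
  c.e.mapDerivedCategoryFactors.hom.naturality f

/-- The universal morphism from `Q P` to the functor induced by `e`. -/
noncomputable def ηQ (P : CochainComplex 𝓑 ℤ) :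
    Q.obj P ⟶ c.E.obj (Q.obj ((mapCochain c.l).obj P)) :=
  Q.map (c.ηC P) ≫ (c.EQIso _).inv

/-- Both `P` and `l P` are bounded above complexes of projectives, hence K-projective. Morphisms out
of them are homotopy classes of chain maps, on which the termwise adjunction acts. -/
lemma bijective_ηQ (P : CochainComplex 𝓑 ℤ) (a : ℤ) [P.IsStrictlyLE a]
    (hP : ∀ i, Projective (P.X i)) (Y : DerivedCategory 𝓐) :
    Function.Bijective fun g : Q.obj ((mapCochain c.l).obj P) ⟶ Y ↦ c.ηQ P ≫ c.E.map g := by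
  have := CochainComplex.isKProjective_of_projective P a
  have hl (i : ℤ) : Projective (((mapCochain c.l).obj P).X i) := c.projective_l (P.X i)
  have := CochainComplex.isKProjective_of_projective ((mapCochain c.l).obj P) a
  have key (Z : CochainComplex 𝓐 ℤ) (g : (mapCochain c.l).obj P ⟶ Z) :
      (c.ηQ P ≫ c.E.map (Q.map g)) ≫ (c.EQIso Z).hom =
        Q.map (c.ηC P ≫ (mapCochain c.e).map g) := by
    rw [Category.assoc, EQIso_naturality, ηQ, Category.assoc, Iso.inv_hom_id_assoc, Q.map_comp]
  have hQ (Z : CochainComplex 𝓐 ℤ) : Function.Bijective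
      fun g : Q.obj ((mapCochain c.l).obj P) ⟶ Q.obj Z ↦ c.ηQ P ≫ c.E.map g := by
    constructor
    · intro g₁ g₂ h
      obtain ⟨g₁, rfl⟩ := Q_map_surjective_of_isKProjective _ _ g₁
      obtain ⟨g₂, rfl⟩ := Q_map_surjective_of_isKProjective _ _ g₂
      have h' := congrArg (· ≫ (c.EQIso Z).hom) h
      dsimp only at h'
      rw [key, key] at h'
      obtain ⟨H⟩ := nonempty_homotopy_of_isKProjective _ _ h'
      have hg (g : (mapCochain c.l).obj P ⟶ Z) :
          (mapCochain c.l).map (c.ηC P ≫ (mapCochain c.e).map g) ≫ c.counitC Z = g := by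
        rw [Functor.map_comp, Category.assoc, counitC_naturality, ← Category.assoc,
          map_ηC_counitC, Category.id_comp]
      rw [← hg g₁, ← hg g₂]
      exact Q_map_eq_of_homotopy ((c.l.mapHomotopy H).compRight _)
    · intro f
      obtain ⟨f', hf'⟩ := Q_map_surjective_of_isKProjective _ _ (f ≫ (c.EQIso Z).hom)
      refine ⟨Q.map ((mapCochain c.l).map f' ≫ c.counitC Z), ?_⟩
      dsimp only
      rw [← cancel_mono (c.EQIso Z).hom, key, ← hf', (mapCochain c.e).map_comp,
        ← Category.assoc, ← ηC_naturality, Category.assoc, ηC_counitC, Category.comp_id]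
  -- An arbitrary `Y` is replaced by an isomorphic `Q.obj Z`, conjugating both Hom sets.
  let e := Q.objObjPreimageIso Y
  refine (Function.Bijective.of_comp_iff' (Iso.homCongr (Iso.refl (Q.obj P))
    (c.E.mapIso e.symm)).bijective _).1 ?_
  refine (Function.Bijective.of_comp_iff _ (Iso.homCongr (Iso.refl _) e).bijective).1 ?_
  convert hQ (Q.objPreimage Y) using 1
  ext g
  simp [← Functor.map_comp]

lemma isGE_E_iff (X : DerivedCategory 𝓐) (n : ℤ) : (c.E.obj X).IsGE n ↔ X.IsGE n := by
  let e := Q.objObjPreimageIso X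
  have h₁ : X.IsGE n ↔ (Q.objPreimage X).IsGE n := by
    rw [← isGE_Q_obj_iff]
    exact ⟨fun h ↦ TStructure.t.isGE_of_iso e.symm n, fun h ↦ TStructure.t.isGE_of_iso e n⟩
  let e' := c.E.mapIso e.symm ≪≫ c.EQIso _
  have h₂ : (c.E.obj X).IsGE n ↔ ((mapCochain c.e).obj (Q.objPreimage X)).IsGE n := by
    rw [← isGE_Q_obj_iff]
    exact ⟨fun h ↦ TStructure.t.isGE_of_iso e' n, fun h ↦ TStructure.t.isGE_of_iso e'.symm n⟩
  rw [h₁, h₂, CochainComplex.isGE_iff, CochainComplex.isGE_iff]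
  simp only [exactAt_iff_map_e]

lemma isLE_E_iff (X : DerivedCategory 𝓐) (n : ℤ) : (c.E.obj X).IsLE n ↔ X.IsLE n := by
  let e := Q.objObjPreimageIso X
  have h₁ : X.IsLE n ↔ (Q.objPreimage X).IsLE n := by
    rw [← isLE_Q_obj_iff]
    exact ⟨fun h ↦ TStructure.t.isLE_of_iso e.symm n, fun h ↦ TStructure.t.isLE_of_iso e n⟩
  let e' := c.E.mapIso e.symm ≪≫ c.EQIso _
  have h₂ : (c.E.obj X).IsLE n ↔ ((mapCochain c.e).obj (Q.objPreimage X)).IsLE n := by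
    rw [← isLE_Q_obj_iff]
    exact ⟨fun h ↦ TStructure.t.isLE_of_iso e' n, fun h ↦ TStructure.t.isLE_of_iso e'.symm n⟩
  rw [h₁, h₂, CochainComplex.isLE_iff, CochainComplex.isLE_iff]
  simp only [exactAt_iff_map_e]

end Derived

end CleftExtension

/-! ### Sections and retractions in a triangulated category. -/

section Triangulated

open Pretriangulated

variable {𝓣 : Type u₁} [Category.{v₁} 𝓣] [HasZeroObject 𝓣] [HasShift 𝓣 ℤ] [Preadditive 𝓣]
  [∀ n : ℤ, (shiftFunctor 𝓣 n).Additive] [Pretriangulated 𝓣] [IsTriangulated 𝓣]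

/-- The cone of a section of a morphism identifies to the cocone of this morphism. -/
lemma nonempty_iso_of_section {X M Z K : 𝓣} {s : X ⟶ M} {p : M ⟶ X} (hsp : s ≫ p = 𝟙 X)
    {v : M ⟶ Z} {w : Z ⟶ X⟦(1 : ℤ)⟧} (h₁ : Triangle.mk s v w ∈ distTriang 𝓣)
    {f : K ⟶ M} {g : X ⟶ K⟦(1 : ℤ)⟧} (h₂ : Triangle.mk f p g ∈ distTriang 𝓣) :
    Nonempty (K ≅ Z) := by
  -- The octahedron on `s ≫ p = 𝟙 X` has the cone of an identity as third cone, so the connecting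
  -- map `K⟦1⟧ ⟶ Z⟦1⟧` is invertible.
  let o := Triangulated.someOctahedron hsp h₁ (rot_of_distTriang _ h₂)
    (contractible_distinguished X)
  have h := (Triangle.isZero₂_iff_isIso₃ _ o.mem).1 (isZero_zero 𝓣)
  exact ⟨(shiftFunctor 𝓣 (1 : ℤ)).preimageIso (@asIso _ _ _ _ _ h)⟩

end Triangulated

/-! ### The left adjoint of `eb` on bounded derived categories. -/

namespace CleftExtension

open DerivedCategory

variable {𝓑 : Type u₁} [Category.{v₁} 𝓑] [Abelian 𝓑]
  {𝓐 : Type u₂} [Category.{v₂} 𝓐] [Abelian 𝓐] (c : CleftExtension 𝓑 𝓐)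

variable [HasDerivedCategory.{w₁} 𝓑] [HasDerivedCategory.{w₂} 𝓐]

lemma bounded_E_iff (X : DerivedCategory 𝓐) :
    TStructure.t.bounded (c.E.obj X) ↔ TStructure.t.bounded X := by
  change (∃ n, (c.E.obj X).IsGE n) ∧ (∃ n, (c.E.obj X).IsLE n) ↔ (∃ n, X.IsGE n) ∧ ∃ n, X.IsLE n
  simp only [isGE_E_iff, isLE_E_iff]

/-- The functor induced by `e` on bounded derived categories. -/
noncomputable def eb : Bounded 𝓐 ⥤ Bounded 𝓑 :=
  TStructure.t.bounded.lift (Bounded.ι ⋙ c.E) fun X ↦ (c.bounded_E_iff X.obj).2 X.property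

noncomputable instance : (c.eb).CommShift ℤ := by
  unfold eb
  infer_instance

instance : (c.eb).IsTriangulated := by
  unfold eb
  infer_instance

lemma exists_projective_of_bounded [EnoughProjectives 𝓑] (X : Bounded 𝓑) :
    ∃ (P : CochainComplex 𝓑 ℤ) (a b : ℤ), P.IsStrictlyLE a ∧ (∀ i, Projective (P.X i)) ∧
      (∀ i < b, P.ExactAt i) ∧ Nonempty (X.obj ≅ Q.obj P) := by
  obtain ⟨⟨b, hb⟩, ⟨a, ha⟩⟩ : (∃ n, X.obj.IsGE n) ∧ ∃ n, X.obj.IsLE n := X.property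
  obtain ⟨K, _, ⟨e⟩⟩ := X.obj.exists_iso_Q_obj_of_isLE a
  obtain ⟨P, f, _, hP, hPa⟩ := exists_quasiIso_projective K a
  let e' : X.obj ≅ Q.obj P := e ≪≫ (asIso (Q.map f)).symm
  refine ⟨P, a, b, hPa, hP, ?_, ⟨e'⟩⟩
  rw [← CochainComplex.isGE_iff, ← isGE_Q_obj_iff]
  exact TStructure.t.isGE_of_iso e' b

/-- The object is `l P` and the triangle comes from `P ⟶ e (l P) ⟶ F P`. Vanishing of one derived
functor of `F` on all objects is what keeps `l P` cohomologically bounded below. -/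
lemma exists_universal [EnoughProjectives 𝓑] {N : ℕ}
    (hN : ∀ X, IsZero ((c.F.leftDerived (N + 1)).obj X)) (X : Bounded 𝓑)
    (P : CochainComplex 𝓑 ℤ) (a : ℤ) [P.IsStrictlyLE a] (hP : ∀ i, Projective (P.X i))
    (e : X.obj ≅ Q.obj P) :
    ∃ (X' : Bounded 𝓐) (u : X ⟶ c.eb.obj X'),
      (∀ Y : Bounded 𝓐, Function.Bijective fun g : X' ⟶ Y ↦ u ≫ c.eb.map g) ∧
      ∃ (v : (c.eb.obj X').obj ⟶ Q.obj ((mapCochain c.F).obj P)) (w : _),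
        Pretriangulated.Triangle.mk u.hom v w ∈ Pretriangulated.distinguishedTriangles := by
  obtain ⟨b, hb⟩ : ∃ b, X.obj.IsGE b := X.property.1
  have hPb : ∀ i < b, P.ExactAt i := by
    rw [← CochainComplex.isGE_iff, ← isGE_Q_obj_iff]
    exact TStructure.t.isGE_of_iso e b
  have hl : (Q.obj ((mapCochain c.l).obj P)).IsGE (b - N) := by
    rw [isGE_Q_obj_iff, CochainComplex.isGE_iff]
    intro i hi
    exact c.exactAt_map_l P i (hPb i (by lia)) (exactAt_map_of_projective c.F P N hN b hPb i
      (by lia))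
  have hl' : (Q.obj ((mapCochain c.l).obj P)).IsLE a := by
    rw [isLE_Q_obj_iff]
    have : ((mapCochain c.l).obj P).IsStrictlyLE a := inferInstance
    infer_instance
  let X' : Bounded 𝓐 := ⟨Q.obj ((mapCochain c.l).obj P), ⟨_, hl⟩, ⟨_, hl'⟩⟩
  let u₀ : X.obj ⟶ c.E.obj (Q.obj ((mapCochain c.l).obj P)) := e.hom ≫ c.ηQ P
  let u : X ⟶ c.eb.obj X' := ObjectProperty.homMk u₀
  refine ⟨X', u, fun Y ↦ ?_, (c.EQIso _).hom ≫ Q.map (c.σC P),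
    triangleOfSESδ (c.shortExact_ηC_σC P) ≫ e.inv⟦(1 : ℤ)⟧', ?_⟩
  · constructor
    · intro g₁ g₂ h
      have h' : u₀ ≫ c.E.map g₁.hom = u₀ ≫ c.E.map g₂.hom :=
        congrArg InducedCategory.Hom.hom h
      simp only [u₀, Category.assoc, Iso.cancel_iso_hom_left] at h'
      exact ObjectProperty.hom_ext _ ((c.bijective_ηQ P a hP Y.obj).injective h')
    · intro f
      let f₀ : X.obj ⟶ c.E.obj Y.obj := f.hom
      obtain ⟨g, hg⟩ := (c.bijective_ηQ P a hP Y.obj).surjective (e.inv ≫ f₀)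
      refine ⟨ObjectProperty.homMk g, ObjectProperty.hom_ext _ ?_⟩
      change u₀ ≫ c.E.map g = f₀
      dsimp only at hg
      rw [Category.assoc, hg, Iso.hom_inv_id_assoc]
  · refine Pretriangulated.isomorphic_distinguished _
      (triangleOfSES_distinguished (c.shortExact_ηC_σC P)) _
      (Pretriangulated.Triangle.isoMk _ _ e (c.EQIso _) (Iso.refl _) ?_ ?_ ?_)
    · change (e.hom ≫ Q.map (c.ηC P) ≫ (c.EQIso _).inv) ≫ (c.EQIso _).hom = e.hom ≫ Q.map (c.ηC P)
      simp
    · exact Category.comp_id _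
    · let δ : Q.obj ((mapCochain c.F).obj P) ⟶ (Q.obj P)⟦(1 : ℤ)⟧ :=
        triangleOfSESδ (c.shortExact_ηC_σC P)
      have key : (δ ≫ e.inv⟦(1 : ℤ)⟧') ≫ e.hom⟦(1 : ℤ)⟧' = 𝟙 _ ≫ δ := by
        rw [Category.assoc, ← Functor.map_comp, Iso.inv_hom_id, CategoryTheory.Functor.map_id,
          Category.comp_id,
          Category.id_comp]
      exact key

open Opposite in
lemma eb_isRightAdjoint [EnoughProjectives 𝓑] {N : ℕ}
    (hN : ∀ X, IsZero ((c.F.leftDerived (N + 1)).obj X)) : c.eb.IsRightAdjoint := by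
  apply Functor.isRightAdjoint_of_leftAdjointObjIsDefined_eq_top
  ext X
  simp only [Functor.leftAdjointObjIsDefined_iff, Pi.top_apply, Prop.top_eq_true, iff_true]
  obtain ⟨P, a, -, _, hP, -, ⟨e⟩⟩ := exists_projective_of_bounded X
  obtain ⟨X', u, hu, -⟩ := c.exists_universal hN X P a hP e
  exact ⟨X', ⟨{
    homEquiv := fun {Y} ↦ Equiv.ofBijective _ (hu Y)
    homEquiv_comp := fun g f ↦ by simp }⟩⟩

section Adjoint

open Pretriangulated

variable {c} {L : Bounded 𝓑 ⥤ Bounded 𝓐} (adj : L ⊣ c.eb)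

/-- The cone of the unit at `eb Y` is `F P`, since the unit agrees with the arrow of
`exists_universal` up to isomorphism. The unit is a section of the image of the counit, so this cone
is also the image of the cocone of the counit. -/
lemma exists_triangle_counit [EnoughProjectives 𝓑] {N : ℕ}
    (hN : ∀ X, IsZero ((c.F.leftDerived (N + 1)).obj X)) (Y : Bounded 𝓐)
    (P : CochainComplex 𝓑 ℤ) (a : ℤ) [P.IsStrictlyLE a] (hP : ∀ i, Projective (P.X i))
    (e : (c.eb.obj Y).obj ≅ Q.obj P) :
    ∃ (Y' : Bounded 𝓐) (f : Y' ⟶ L.obj (c.eb.obj Y)) (g : Y ⟶ Y'⟦(1 : ℤ)⟧),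
      Triangle.mk f (adj.counit.app Y) g ∈ distinguishedTriangles ∧
      Nonempty ((c.eb.obj Y').obj ≅ Q.obj ((mapCochain c.F).obj P)) := by
  obtain ⟨X', u, hu, v, w, h₁⟩ := c.exists_universal hN (c.eb.obj Y) P a hP e
  obtain ⟨θ, hθ⟩ := (hu _).surjective (adj.unit.app (c.eb.obj Y))
  obtain ⟨θ', hθ'⟩ : ∃ θ', adj.unit.app (c.eb.obj Y) ≫ c.eb.map θ' = u :=
    ⟨(adj.homEquiv _ _).symm u, (adj.homEquiv_unit _ _ _).symm.trans (Equiv.apply_symm_apply _ _)⟩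
  dsimp only at hθ
  have h₁' : θ' ≫ θ = 𝟙 _ := by
    apply (adj.homEquiv _ _).injective
    simp [adj.homEquiv_unit, reassoc_of% hθ', hθ]
  have h₂' : θ ≫ θ' = 𝟙 _ := by
    apply (hu _).injective
    simp [reassoc_of% hθ, hθ']
  let i : (c.eb.obj X').obj ≅ (c.eb.obj (L.obj (c.eb.obj Y))).obj :=
    (c.eb ⋙ Bounded.ι).mapIso ⟨θ, θ', h₂', h₁'⟩
  obtain ⟨Y', f, g, h₂⟩ := distinguished_cocone_triangle₁ (adj.counit.app Y)
  refine ⟨Y', f, g, h₂, ?_⟩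
  have h₃ : Triangle.mk (adj.unit.app (c.eb.obj Y)).hom (i.inv ≫ v) w ∈ distinguishedTriangles := by
    refine isomorphic_distinguished _ h₁ _ (Triangle.isoMk _ _ (Iso.refl _) i.symm (Iso.refl _)
      ?_ ?_ ?_)
    · exact (congrArg InducedCategory.Hom.hom hθ').trans (Category.id_comp _).symm
    · exact Category.comp_id _
    · change w ≫ (𝟙 _)⟦(1 : ℤ)⟧' = 𝟙 _ ≫ w
      simp
  exact nonempty_iso_of_section (congrArg InducedCategory.Hom.hom
    (adj.right_triangle_components Y)) h₃ ((c.eb ⋙ Bounded.ι).map_distinguished _ h₂)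

end Adjoint

end CleftExtension

/-! ### Rouquier dimension and triangulated functors. -/

section Triangulated

open Pretriangulated

variable {𝓢 : Type u₁} [Category.{v₁} 𝓢] [HasZeroObject 𝓢] [HasShift 𝓢 ℤ] [Preadditive 𝓢]
  [∀ n : ℤ, (shiftFunctor 𝓢 n).Additive] [Pretriangulated 𝓢]
  {𝓣 : Type u₂} [Category.{v₂} 𝓣] [HasZeroObject 𝓣] [HasShift 𝓣 ℤ] [Preadditive 𝓣]
  [∀ n : ℤ, (shiftFunctor 𝓣 n).Additive] [Pretriangulated 𝓣]

lemma triangEnvelopeIter_map (Φ : 𝓢 ⥤ 𝓣) [Φ.CommShift ℤ] [Φ.IsTriangulated]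
    {P : ObjectProperty 𝓢} {P' : ObjectProperty 𝓣} (h : P ≤ P'.inverseImage Φ) (n : ℕ) :
    P.triangEnvelopeIter n ≤ (P'.triangEnvelopeIter n).inverseImage Φ := by
  have h₀ : (P.shiftClosure ℤ).binaryProductsClosure.retractClosure ≤
      ((P'.shiftClosure ℤ).binaryProductsClosure.retractClosure).inverseImage Φ := by
    have : PreservesLimitsOfShape (Discrete WalkingPair) Φ := inferInstance
    have h₁ : P.shiftClosure ℤ ≤ (P'.shiftClosure ℤ).inverseImage Φ := by
      rw [ObjectProperty.shiftClosure_le_iff]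
      exact fun X hX ↦ ObjectProperty.le_shiftClosure _ _ (h X hX)
    have h₂ : (P.shiftClosure ℤ).binaryProductsClosure ≤
        (P'.shiftClosure ℤ).binaryProductsClosure.inverseImage Φ :=
      ObjectProperty.limitsClosure_le fun X hX ↦ ObjectProperty.le_limitsClosure _ _ _ (h₁ X hX)
    rintro X ⟨Y, hY, ⟨r⟩⟩
    exact ⟨Φ.obj Y, h₂ _ hY, ⟨r.map Φ⟩⟩
  induction n with
  | zero => simpa only [ObjectProperty.triangEnvelopeIter_zero] using h₀
  | succ n ih =>
    rw [ObjectProperty.triangEnvelopeIter_succ, ObjectProperty.triangEnvelopeIter_succ]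
    rintro X ⟨X', ⟨Y, Z, f, g, k, hT, hY, hZ⟩, ⟨r⟩⟩
    exact ⟨Φ.obj X', ⟨_, _, _, _, _, Φ.map_distinguished _ hT, h₀ _ hY, ih _ hZ⟩, ⟨r.map Φ⟩⟩

lemma rouquierDim_eq_top_or (𝓣 : Type u₂) [Category.{v₂} 𝓣] [HasZeroObject 𝓣] [HasShift 𝓣 ℤ]
    [Preadditive 𝓣] [∀ n : ℤ, (shiftFunctor 𝓣 n).Additive] [Pretriangulated 𝓣] :
    rouquierDim 𝓣 = ⊤ ∨ ∃ (d : ℕ) (T : 𝓣), rouquierDim 𝓣 = d ∧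
      (ObjectProperty.singleton T).triangEnvelopeIter d = ⊤ := by
  classical
  by_cases h : ∃ (d : ℕ) (T : 𝓣), (ObjectProperty.singleton T).triangEnvelopeIter d = ⊤
  · obtain ⟨T, hT⟩ := Nat.find_spec h
    refine Or.inr ⟨Nat.find h, T, le_antisymm (iInf₂_le _ ⟨T, hT⟩) ?_, hT⟩
    exact le_iInf₂ fun n hn ↦ by exact_mod_cast Nat.find_min' h hn
  · refine Or.inl (iInf₂_eq_top.2 fun n hn ↦ (h ⟨n, hn⟩).elim)

/-- The Rouquier dimension does not increase along an essentially surjective triangulated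
functor. -/
lemma rouquierDim_le_of_essSurj (Φ : 𝓢 ⥤ 𝓣) [Φ.CommShift ℤ] [Φ.IsTriangulated] [Φ.EssSurj] :
    rouquierDim 𝓣 ≤ rouquierDim 𝓢 := by
  refine le_iInf fun n ↦ le_iInf fun ⟨T, hT⟩ ↦ iInf_le_of_le n (iInf_le_of_le ⟨Φ.obj T, ?_⟩ le_rfl)
  rw [eq_top_iff]
  intro X _
  refine ObjectProperty.prop_of_iso _ (Φ.objObjPreimageIso X) ?_
  refine triangEnvelopeIter_map (P := .singleton T) Φ ?_ n _ (by rw [hT]; trivial)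
  rintro _ ⟨⟩
  exact ⟨⟨⟩⟩

end Triangulated

/-! ### The dimension bounds for abelian categories, by induction on nilpotency. -/

namespace CleftExtension

open DerivedCategory Pretriangulated

variable {𝓑 : Type u₁} [Category.{v₁} 𝓑] [Abelian 𝓑] [EnoughProjectives 𝓑]
  {𝓐 : Type u₂} [Category.{v₂} 𝓐] [Abelian 𝓐] (c : CleftExtension 𝓑 𝓐)

variable [HasDerivedCategory.{w₁} 𝓑] [HasDerivedCategory.{w₂} 𝓐]

/-- The objects of the bounded derived category of `𝓐` which, as objects of the derived category
of `𝓑`, are given by bounded above complexes of objects which are acyclic for the powers of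
`F` and are killed by `Fᵏ`. -/
def IsNilpotent (k : ℕ) (Y : Bounded 𝓐) : Prop :=
  ∃ (K : CochainComplex 𝓑 ℤ) (a : ℤ), K.IsStrictlyLE a ∧ (∀ i, IsPowAcyclic c.F (K.X i)) ∧
    (∀ i, IsZero ((endofunctorPow c.F k).obj (K.X i))) ∧ Nonempty ((c.eb.obj Y).obj ≅ Q.obj K)

variable {c}

lemma isNilpotent_of_isZero {k : ℕ} (h : ∀ X, IsZero ((endofunctorPow c.F k).obj X))
    (Y : Bounded 𝓐) : c.IsNilpotent k Y := by
  obtain ⟨P, a, -, hPa, hP, -, he⟩ := exists_projective_of_bounded (c.eb.obj Y)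
  exact ⟨P, a, hPa, fun i ↦ isPowAcyclic_of_projective _ _, fun i ↦ h _, he⟩

/-- `F⁰` is the identity, so the representing complex is zero; and `e` detects cohomological bounds,
which forces `Y` into an empty range of degrees. -/
lemma IsNilpotent.isZero {Y : Bounded 𝓐} (hY : c.IsNilpotent 0 Y) : IsZero Y := by
  obtain ⟨K, a, -, -, hK, ⟨e⟩⟩ := hY
  have hK' : IsZero K := by
    rw [IsZero.iff_id_eq_zero]
    ext i
    exact (hK i).eq_of_src _ _
  have hE : IsZero (c.E.obj Y.obj) := (Q.map_isZero hK').of_iso e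
  have h₁ : Y.obj.IsGE 1 := by
    rw [← c.isGE_E_iff, isGE_iff]
    exact fun i _ ↦ Functor.map_isZero _ hE
  have h₂ : Y.obj.IsLE 0 := by
    rw [← c.isLE_E_iff, isLE_iff]
    exact fun i _ ↦ Functor.map_isZero _ hE
  have hY : IsZero Y.obj := TStructure.t.isZero Y.obj 0 1
  rw [IsZero.iff_id_eq_zero]
  exact ObjectProperty.hom_ext _ (hY.eq_of_src _ _)

variable {L : Bounded 𝓑 ⥤ Bounded 𝓐}

/-- If `P` resolves `K`, the cocone of the counit is represented by `F P`, hence by `F K` because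
the terms of `K` are `F`-acyclic; and `Fᵏ` kills the terms of `F K`. -/
lemma IsNilpotent.exists_triangle (adj : L ⊣ c.eb) (hperf : IsLeftPerfect c.F) {k : ℕ}
    {Y : Bounded 𝓐} (hY : c.IsNilpotent (k + 1) Y) :
    ∃ (Y' : Bounded 𝓐) (f : Y' ⟶ L.obj (c.eb.obj Y)) (g : Y ⟶ Y'⟦(1 : ℤ)⟧),
      Triangle.mk f (adj.counit.app Y) g ∈ distinguishedTriangles ∧ c.IsNilpotent k Y' := by
  obtain ⟨K, a, _, hK, hK₀, ⟨e⟩⟩ := hY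
  obtain ⟨P, f, _, hP, _⟩ := exists_quasiIso_projective K a
  obtain ⟨N, hN⟩ := hperf.exists_bound
  obtain ⟨Y', i, g, hT, ⟨e'⟩⟩ := exists_triangle_counit adj (N := N)
    -- The bound is used only for the first power, which is `F` up to unfolding `𝟭 ⋙ F`.
    (fun X ↦ hN (N + 1) 1 (by lia) (by lia) (by lia) X) Y P a hP
    (e ≪≫ (asIso (Q.map f)).symm)
  have : QuasiIso ((mapCochain c.F).map f) := quasiIso_map_of_isLeftAcyclic c.F f a
    (fun i ↦ isPowAcyclic_of_projective c.F (P.X i) 0) (fun i ↦ hK i 0)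
  refine ⟨Y', i, g, hT, (mapCochain c.F).obj K, a, inferInstance,
    fun i ↦ isPowAcyclic_map c.F hperf (K.X i) (hK i), fun i ↦ ?_,
    ⟨e' ≪≫ asIso (Q.map ((mapCochain c.F).map f))⟩⟩
  exact (hK₀ i).of_iso ((endofunctorPowSuccIso c.F k).symm.app (K.X i))

lemma IsNilpotent.triangEnvelopeIter [L.CommShift ℤ] [L.IsTriangulated]
    (adj : L ⊣ c.eb) (hperf : IsLeftPerfect c.F) {T : Bounded 𝓑} {d : ℕ}
    (hT : (ObjectProperty.singleton T).triangEnvelopeIter d = ⊤) {k : ℕ} {Y : Bounded 𝓐}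
    (hY : c.IsNilpotent (k + 1) Y) :
    (ObjectProperty.singleton (L.obj T)).triangEnvelopeIter (k * (d + 1) + d) Y := by
  have hL (X : Bounded 𝓑) :
      (ObjectProperty.singleton (L.obj T)).triangEnvelopeIter d (L.obj X) := by
    refine triangEnvelopeIter_map (P := .singleton T) L ?_ d _ (by rw [hT]; trivial)
    rintro _ ⟨⟩
    exact ⟨⟨⟩⟩
  induction k generalizing Y with
  | zero =>
    obtain ⟨Y', f, g, hT, hY'⟩ := IsNilpotent.exists_triangle adj hperf hY
    have : IsIso (adj.counit.app Y) := (Triangle.isZero₁_iff_isIso₂ _ hT).1 hY'.isZero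
    rw [zero_mul, zero_add]
    exact ObjectProperty.prop_of_iso _ (asIso (adj.counit.app Y)) (hL _)
  | succ k ih =>
    obtain ⟨Y', f, g, hT, hY'⟩ := IsNilpotent.exists_triangle adj hperf hY
    -- The iterate of index `m` has `m + 1` layers: `d + 1` come from `L (eb Y)`, and the rest from
    -- the shifted cocone.
    rw [show (k + 1) * (d + 1) + d = d + (k * (d + 1) + d + 1) by ring,
      ObjectProperty.triangEnvelopeIter_add' _ rfl]
    refine ObjectProperty.le_retractClosure _ _
      ⟨_, _, _, _, _, rot_of_distTriang _ hT, hL _, ?_⟩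
    exact ObjectProperty.le_shift _ _ _ (ih hY')

variable (c)

/-- Exactness of `i` is not needed: `i` is applied to the terms of one complex, and boundedness of
the result is read off after `e`. -/
instance eb_essSurj : c.eb.EssSurj where
  mem_essImage X := by
    let K := Q.objPreimage X.obj
    let i : c.i ⋙ c.e ≅ 𝟭 𝓑 := c.iso
    let e₁ : (mapCochain c.e).obj ((mapCochain c.i).obj K) ≅ K :=
      HomologicalComplex.Hom.isoOfComponents (fun n ↦ c.isoApp (K.X n))
        fun m n _ ↦ (c.isoApp_hom_naturality (K.d m n)).symm
    let e₂ : c.E.obj (Q.obj ((mapCochain c.i).obj K)) ≅ X.obj :=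
      c.EQIso _ ≪≫ Q.mapIso e₁ ≪≫ Q.objObjPreimageIso X.obj
    exact ⟨⟨Q.obj ((mapCochain c.i).obj K), (c.bounded_E_iff _).1
      (ObjectProperty.prop_of_iso _ e₂.symm X.property)⟩, ⟨ObjectProperty.isoMk _ e₂⟩⟩

/-- The comparison of the Rouquier dimensions in a cleft extension of abelian categories. -/
theorem rouquierDim_bounded_le (hperf : IsLeftPerfect c.F) (n : ℕ) (hn : 0 < n)
    (hnil : ∀ X, IsZero ((endofunctorPow c.F n).obj X)) :
    rouquierDim (Bounded 𝓑) ≤ rouquierDim (Bounded 𝓐) ∧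
      rouquierDim (Bounded 𝓐) ≤ (n : ℕ∞) * (rouquierDim (Bounded 𝓑) + 1) - 1 := by
  refine ⟨rouquierDim_le_of_essSurj c.eb, ?_⟩
  obtain h | ⟨d, T, h, hT⟩ := rouquierDim_eq_top_or (Bounded 𝓑)
  · rw [h, top_add, ENat.mul_top (by simpa using hn.ne')]
    exact le_top.trans (by simp)
  obtain ⟨N, hN⟩ := hperf.exists_bound
  have := c.eb_isRightAdjoint (N := N) (fun X ↦ hN (N + 1) 1 (by lia) (by lia) (by lia) X)
  let adj := Adjunction.ofIsRightAdjoint c.eb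
  let := adj.leftAdjointCommShift ℤ
  have := adj.commShift_of_rightAdjoint ℤ
  have := adj.isTriangulated_leftAdjoint
  obtain ⟨k, rfl⟩ : ∃ k, n = k + 1 := ⟨n - 1, by lia⟩
  have key : (ObjectProperty.singleton (c.eb.leftAdjoint.obj T)).triangEnvelopeIter
      (k * (d + 1) + d) = ⊤ := by
    rw [eq_top_iff]
    exact fun Y _ ↦ (isNilpotent_of_isZero hnil Y).triangEnvelopeIter adj hperf hT
  refine (iInf₂_le _ ⟨_, key⟩).trans ?_
  rw [h]
  -- The truncated subtraction is harmless, since the product is at least one.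
  have : k * (d + 1) + d = (k + 1) * (d + 1) - 1 := by
    rw [add_mul, one_mul]
    lia
  rw [this]
  push_cast
  exact le_rfl

end CleftExtension

/-! ### Descent of left perfectness along an exact faithful functor. -/

section Transfer

variable {𝓑' : Type u₁} [Category.{v₁} 𝓑'] [Abelian 𝓑']
  {𝓑 : Type u₂} [Category.{v₂} 𝓑] [Abelian 𝓑]
  (ι : 𝓑' ⥤ 𝓑) [ι.Additive] [ι.Faithful] [PreservesFiniteLimits ι] [PreservesFiniteColimits ι]
  {Φ' : 𝓑' ⥤ 𝓑'} {Φ : 𝓑 ⥤ 𝓑}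

lemma exactAt_map_iff_of_faithful (K : CochainComplex 𝓑' ℤ) (i : ℤ) :
    ((mapCochain ι).obj K).ExactAt i ↔ K.ExactAt i :=
  ShortComplex.exact_map_iff_of_faithful (K.sc i) ι

/-- The powers of endofunctors which are compatible with a functor are compatible with it. -/
noncomputable def endofunctorPowCompIso (τ : Φ' ⋙ ι ≅ ι ⋙ Φ) (n : ℕ) :
    endofunctorPow Φ' n ⋙ ι ≅ ι ⋙ endofunctorPow Φ n :=
  match n with
  | 0 => Functor.leftUnitor _ ≪≫ (Functor.rightUnitor _).symm
  | n + 1 => Functor.associator _ _ _ ≪≫ Functor.isoWhiskerLeft _ τ ≪≫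
      (Functor.associator _ _ _).symm ≪≫
      Functor.isoWhiskerRight (endofunctorPowCompIso τ n) Φ ≪≫ Functor.associator _ _ _

variable [EnoughProjectives 𝓑'] [EnoughProjectives 𝓑]
variable [Φ'.Additive] [Φ.Additive]

/-- The functor `ι` carries a projective resolution of `X` to one of `ι X`, and it detects exactness
after applying the endofunctors. -/
lemma isZero_leftDerived_iff_of_faithful [PreservesFiniteColimits Φ'] [PreservesFiniteColimits Φ]
    (hι : ∀ X, Projective X → Projective (ι.obj X)) (τ : Φ' ⋙ ι ≅ ι ⋙ Φ) (n : ℕ) (X : 𝓑') :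
    IsZero ((Φ'.leftDerived (n + 1)).obj X) ↔ IsZero ((Φ.leftDerived (n + 1)).obj (ι.obj X)) := by
  obtain ⟨P, hP, hP₀, hPe, ⟨e⟩⟩ := exists_projective_complex X
  have hP' (i : ℤ) : Projective (((mapCochain ι).obj P).X i) := hι _ (hP i)
  let e' : ((mapCochain ι).obj P).opcycles 0 ≅ ι.obj X :=
    mapOpcyclesIso ι P (-1) 0 (by simp) ≪≫ ι.mapIso e
  rw [← ((Φ'.leftDerived (n + 1)).mapIso e).isZero_iff,
    ← ((Φ.leftDerived (n + 1)).mapIso e').isZero_iff,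
    isZero_leftDerived_opcycles_iff Φ' P n 0 (-(n : ℤ) - 1) hPe (by lia),
    isZero_leftDerived_opcycles_iff Φ _ n 0 (-(n : ℤ) - 1)
      (fun i hi ↦ (exactAt_map_iff_of_faithful ι P i).2 (hPe i hi)) (by lia),
    ← exactAt_map_iff_of_faithful ι]
  exact exactAt_iff_of_natIso τ P _

lemma IsLeftPerfect.of_faithful [PreservesFiniteColimits Φ'] [PreservesFiniteColimits Φ]
    (hι : ∀ X, Projective X → Projective (ι.obj X)) (τ : Φ' ⋙ ι ≅ ι ⋙ Φ)
    (hΦ : IsLeftPerfect Φ) : IsLeftPerfect Φ' where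
  isZero_leftDerived_projective P hP i j hi hj := by
    obtain ⟨i, rfl⟩ : ∃ k, i = k + 1 := ⟨i - 1, by lia⟩
    rw [isZero_leftDerived_iff_of_faithful ι hι (endofunctorPowCompIso ι τ j)]
    exact (hΦ.isZero_leftDerived_projective _ (hι P hP) (i + 1) j hi hj).of_iso
      (((endofunctorPow Φ j).leftDerived (i + 1)).mapIso (τ.app P))
  exists_bound := by
    obtain ⟨n, hn⟩ := hΦ.exists_bound
    refine ⟨n, fun p q hp hq h X ↦ ?_⟩
    obtain ⟨p, rfl⟩ : ∃ k, p = k + 1 := ⟨p - 1, by lia⟩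
    rw [isZero_leftDerived_iff_of_faithful ι hι (endofunctorPowCompIso ι τ q)]
    exact hn _ _ hp hq h _

end Transfer

/-! ### Restriction of a cleft extension to finitely generated modules. -/

section FG

variable (R : Type u) [Ring R] [IsNoetherianRing R]

/-- The inclusion of the category of finitely generated modules. -/
abbrev FGModuleCat.ι : FGModuleCat.{u} R ⥤ ModuleCat.{u} R := (ModuleCat.isFG R).ι

instance : PreservesFiniteLimits (FGModuleCat.ι R) :=
  inferInstanceAs (PreservesFiniteLimits (forget₂ (FGModuleCat R) (ModuleCat R)))

instance : PreservesFiniteColimits (FGModuleCat.ι R) :=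
  inferInstanceAs (PreservesFiniteColimits (forget₂ (FGModuleCat R) (ModuleCat R)))

end FG

namespace CleftExtension

variable {R S : Type u} [Ring R] [Ring S] [IsNoetherianRing R] [IsNoetherianRing S]
  (c : CleftExtension (ModuleCat.{u} S) (ModuleCat.{u} R))

/-- A cleft extension of module categories which preserves finitely generated modules. -/
structure PreservesFG : Prop where
  i : ∀ X, ModuleCat.isFG S X → ModuleCat.isFG R (c.i.obj X)
  e : ∀ X, ModuleCat.isFG R X → ModuleCat.isFG S (c.e.obj X)
  l : ∀ X, ModuleCat.isFG S X → ModuleCat.isFG R (c.l.obj X)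

variable {c} (hc : c.PreservesFG)

namespace PreservesFG

/-- The restriction of a cleft extension to finitely generated modules. -/
noncomputable def restrict : CleftExtension (FGModuleCat.{u} S) (FGModuleCat.{u} R) where
  i := (ModuleCat.isFG R).lift (FGModuleCat.ι S ⋙ c.i) fun X ↦ hc.i _ X.property
  e := (ModuleCat.isFG S).lift (FGModuleCat.ι R ⋙ c.e) fun X ↦ hc.e _ X.property
  l := (ModuleCat.isFG R).lift (FGModuleCat.ι S ⋙ c.l) fun X ↦ hc.l _ X.property
  i_additive := by
    have : ((ModuleCat.isFG R).lift (FGModuleCat.ι S ⋙ c.i) (fun X ↦ hc.i _ X.property) ⋙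
      FGModuleCat.ι R).Additive := inferInstanceAs (FGModuleCat.ι S ⋙ c.i).Additive
    exact Functor.additive_of_comp_faithful _ (FGModuleCat.ι R)
  e_additive := by
    have : ((ModuleCat.isFG S).lift (FGModuleCat.ι R ⋙ c.e) (fun X ↦ hc.e _ X.property) ⋙
      FGModuleCat.ι S).Additive := inferInstanceAs (FGModuleCat.ι R ⋙ c.e).Additive
    exact Functor.additive_of_comp_faithful _ (FGModuleCat.ι S)
  e_faithful := inferInstance
  e_preservesFiniteLimits := by
    have : PreservesFiniteLimits ((ModuleCat.isFG S).lift (FGModuleCat.ι R ⋙ c.e)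
        (fun X ↦ hc.e _ X.property) ⋙ FGModuleCat.ι S) :=
      inferInstanceAs (PreservesFiniteLimits (FGModuleCat.ι R ⋙ c.e))
    exact ⟨fun J _ _ ↦ preservesLimitsOfShape_of_reflects_of_preserves _ (FGModuleCat.ι S)⟩
  e_preservesFiniteColimits := by
    have : PreservesFiniteColimits ((ModuleCat.isFG S).lift (FGModuleCat.ι R ⋙ c.e)
        (fun X ↦ hc.e _ X.property) ⋙ FGModuleCat.ι S) :=
      inferInstanceAs (PreservesFiniteColimits (FGModuleCat.ι R ⋙ c.e))
    exact ⟨fun J _ _ ↦ preservesColimitsOfShape_of_reflects_of_preserves _ (FGModuleCat.ι S)⟩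
  adj :=
    { unit := { app := fun X ↦ ObjectProperty.homMk (c.η X.obj)
                naturality := fun _ _ f ↦ ObjectProperty.hom_ext _ (c.η_naturality f.hom) }
      counit := { app := fun Y ↦ ObjectProperty.homMk (c.adj.counit.app Y.obj)
                  naturality := fun _ _ f ↦
                    ObjectProperty.hom_ext _ (c.counit_naturality f.hom) }
      left_triangle_components := fun X ↦
        ObjectProperty.hom_ext _ (c.adj.left_triangle_components X.obj)
      right_triangle_components := fun Y ↦
        ObjectProperty.hom_ext _ (c.adj.right_triangle_components Y.obj) }
  iso := NatIso.ofComponents (fun X ↦ ObjectProperty.isoMk _ (c.isoApp X.obj)) fun f ↦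
    ObjectProperty.hom_ext _ (c.isoApp_hom_naturality f.hom)

/-- The inclusion of `G Y` in `l (e Y)` in the ambient category. -/
noncomputable def Gι (Y : FGModuleCat R) :
    (hc.restrict.G.obj Y).obj ⟶ c.l.obj (c.e.obj Y.obj) := (hc.restrict.Gι Y).hom

lemma Gι_counit (Y : FGModuleCat R) : hc.Gι Y ≫ c.adj.counit.app Y.obj = 0 :=
  congrArg InducedCategory.Hom.hom (hc.restrict.Gι_counit Y)

lemma shortExact_counit (Y : FGModuleCat R) :
    (ShortComplex.mk (hc.Gι Y) (c.adj.counit.app Y.obj) (hc.Gι_counit Y)).ShortExact :=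
  (hc.restrict.shortExact_counit Y).map_of_exact (FGModuleCat.ι R)

/-- The kernel of the counit is computed in the ambient category. -/
noncomputable def restrictGIso (Y : FGModuleCat R) :
    (hc.restrict.G.obj Y).obj ≅ c.G.obj Y.obj :=
  IsLimit.conePointUniqueUpToIso (hc.shortExact_counit Y).fIsKernel
    (limit.isLimit (parallelPair (c.adj.counit.app Y.obj) 0))

lemma restrictGIso_hom_Gι (Y : FGModuleCat R) :
    (hc.restrictGIso Y).hom ≫ c.Gι Y.obj = hc.Gι Y :=
  IsLimit.conePointUniqueUpToIso_hom_comp _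
    (limit.isLimit (parallelPair (c.adj.counit.app Y.obj) 0))
    WalkingParallelPair.zero

/-- The endofunctor induced by a restricted cleft extension. -/
noncomputable def restrictFIso :
    hc.restrict.F ⋙ FGModuleCat.ι S ≅ FGModuleCat.ι S ⋙ c.F :=
  NatIso.ofComponents
    (fun X ↦ c.e.mapIso (hc.restrictGIso (hc.restrict.i.obj X))) fun {X Y} f ↦ by
      let Z := hc.restrict.i.obj Y
      let W := hc.restrict.i.obj X
      let g : W ⟶ Z := hc.restrict.i.map f
      have key : (hc.restrict.G.map g).hom ≫ (hc.restrictGIso Z).hom =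
          (hc.restrictGIso W).hom ≫ c.G.map g.hom := by
        rw [← cancel_mono (c.Gι _), Category.assoc, Category.assoc, restrictGIso_hom_Gι,
          Gι_naturality]
        refine Eq.trans ?_ ((congrArg (· ≫ _) (hc.restrictGIso_hom_Gι W)).symm.trans
          (Category.assoc _ _ _))
        exact congrArg InducedCategory.Hom.hom (hc.restrict.Gι_naturality g)
      exact (c.e.map_comp _ _).symm.trans ((congrArg c.e.map key).trans (c.e.map_comp _ _))

end PreservesFG

end CleftExtension

/-! ### The map `γ` and a Nakayama-type argument for nilpotent `F`. -/

namespace CleftExtension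

section Abelian

variable {𝓑 : Type u₁} [Category.{v₁} 𝓑] [Abelian 𝓑]
  {𝓐 : Type u₂} [Category.{v₂} 𝓐] [Abelian 𝓐] (c : CleftExtension 𝓑 𝓐)

instance i_faithful : c.i.Faithful := Functor.Faithful.of_comp_iso c.iso

instance i_preservesMonomorphisms : c.i.PreservesMonomorphisms where
  preserves {X Y} f hf := by
    refine c.e.mono_of_mono_map ?_
    have : Mono ((𝟭 𝓑).map f) := hf
    have h : c.e.map (c.i.map f) = (c.isoApp X).hom ≫ f ≫ (c.isoApp Y).inv := by
      rw [← Category.assoc, ← c.isoApp_hom_naturality, Category.assoc, Iso.hom_inv_id,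
        Category.comp_id]
    rw [h]
    infer_instance

/-- The comparison `G (i (e Y)) ⟶ Y` measuring to what extent `Y` is not of the form `i X`. -/
noncomputable def γ (Y : 𝓐) : c.G.obj (c.i.obj (c.e.obj Y)) ⟶ Y :=
  c.Gι _ ≫ c.l.map (c.isoApp (c.e.obj Y)).hom ≫ c.adj.counit.app Y

lemma G_map_i_map_Gι {X Y : 𝓑} (f : X ⟶ Y) :
    c.G.map (c.i.map f) ≫ c.Gι _ ≫ c.l.map (c.isoApp Y).hom =
      c.Gι _ ≫ c.l.map (c.isoApp X).hom ≫ c.l.map f := by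
  rw [reassoc_of% c.Gι_naturality, ← c.l.map_comp, ← c.l.map_comp, isoApp_hom_naturality]

lemma γ_naturality {Y Z : 𝓐} (f : Y ⟶ Z) :
    c.G.map (c.i.map (c.e.map f)) ≫ c.γ Z = c.γ Y ≫ f := by
  have h := c.G_map_i_map_Gι (c.e.map f) =≫ c.adj.counit.app Z
  simp only [Category.assoc, c.counit_naturality] at h
  simpa only [γ, Category.assoc] using h

/-- Writing `q` through its adjoint `f : Z ⟶ e Q`, naturality factors the given epimorphism as `G (i
f)` followed by `γ Q`. -/
lemma epi_γ_of_epi {Z : 𝓑} {Q : 𝓐} (q : c.l.obj Z ⟶ Q)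
    [Epi (c.Gι (c.i.obj Z) ≫ c.l.map (c.isoApp Z).hom ≫ q)] : Epi (c.γ Q) := by
  let f : Z ⟶ c.e.obj Q := c.η Z ≫ c.e.map q
  have hf : c.l.map f ≫ c.adj.counit.app Q = q := by
    rw [c.l.map_comp, Category.assoc, c.counit_naturality, ← Category.assoc]
    exact (congrArg (· ≫ q) (c.adj.left_triangle_components Z)).trans (Category.id_comp q)
  have h : c.G.map (c.i.map f) ≫ c.γ Q =
      c.Gι (c.i.obj Z) ≫ c.l.map (c.isoApp Z).hom ≫ q := by
    have h := c.G_map_i_map_Gι f =≫ c.adj.counit.app Q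
    simp only [Category.assoc, hf] at h
    exact h
  exact epi_of_epi_fac h

/-- Applying `e` to `γ Q` gives an epimorphism `F (e Q) ⟶ e Q`. Since `F` is right exact it can be
iterated, so `e Q` is a quotient of `Fⁿ (e Q) = 0`. -/
lemma isZero_of_epi_γ {n : ℕ} (hnil : ∀ X, IsZero ((endofunctorPow c.F n).obj X))
    (Q : 𝓐) [Epi (c.γ Q)] : IsZero Q := by
  have h (k : ℕ) : ∃ f : (endofunctorPow c.F k).obj (c.e.obj Q) ⟶ c.e.obj Q, Epi f := by
    induction k with
    | zero => exact ⟨𝟙 (c.e.obj Q), inferInstanceAs (Epi (𝟙 (c.e.obj Q)))⟩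
    | succ k ih =>
      obtain ⟨f, hf⟩ := ih
      let g : c.F.obj (c.e.obj Q) ⟶ c.e.obj Q := c.e.map (c.γ Q)
      have : Epi g := inferInstanceAs (Epi (c.e.map (c.γ Q)))
      have h : Epi (c.F.map f ≫ g) := epi_comp _ _
      exact ⟨c.F.map f ≫ g, h⟩
  obtain ⟨f, hf⟩ := h n
  have hz : IsZero (c.e.obj Q) := (hnil (c.e.obj Q)).of_epi f
  rw [IsZero.iff_id_eq_zero]
  exact c.e.map_injective (hz.eq_of_src _ _)

/-- If `γ W` vanishes, then `W` is in the essential image of `i`. -/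
lemma nonempty_iso_of_γ_eq_zero {W : 𝓐} (hW : c.γ W = 0) :
    Nonempty (c.i.obj (c.e.obj W) ≅ W) := by
  obtain ⟨φ, hφ⟩ : ∃ φ : c.i.obj (c.e.obj W) ⟶ W, c.adj.counit.app (c.i.obj (c.e.obj W)) ≫ φ =
      c.l.map (c.isoApp (c.e.obj W)).hom ≫ c.adj.counit.app W :=
    ⟨_, (c.shortExact_counit _).gIsCokernel.fac (CokernelCofork.ofπ _ hW)
      WalkingParallelPair.one⟩
  have h : c.e.map φ = (c.isoApp (c.e.obj W)).hom := by
    have h := c.η (c.e.obj (c.i.obj (c.e.obj W))) ≫= congrArg c.e.map hφ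
    rw [c.e.map_comp, ← Category.assoc, η_counit, Category.id_comp] at h
    rw [h, c.e.map_comp, ← Category.assoc, ← η_naturality, Category.assoc, η_counit,
      Category.comp_id]
  have : IsIso (c.e.map φ) := h ▸ inferInstance
  have : IsIso φ := isIso_of_reflects_iso φ c.e
  exact ⟨asIso φ⟩

lemma epi_G_map_i_map {X Y : 𝓑} (f : X ⟶ Y) [Epi f] : Epi (c.G.map (c.i.map f)) :=
  c.e.epi_of_epi_map (inferInstanceAs (Epi (c.F.map f)))

end Abelian

end CleftExtension

/-! ### Finite generation under functors between module categories. -/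

namespace ModuleCat

variable {R S : Type u} [Ring R] [Ring S]

lemma isFG_of_epi {X Y : ModuleCat.{u} R} (f : X ⟶ Y) [Epi f] (hX : isFG R X) : isFG R Y :=
  have : Module.Finite R X := hX
  Module.Finite.of_surjective f.hom ((epi_iff_surjective f).1 inferInstance)

lemma isFG_of_iso {X Y : ModuleCat.{u} R} (f : X ≅ Y) (hX : isFG R X) : isFG R Y :=
  isFG_of_epi f.hom hX

lemma isFG_of_isZero {X : ModuleCat.{u} R} (hX : IsZero X) : isFG R X := by
  have := ModuleCat.subsingleton_of_isZero hX
  exact inferInstanceAs (Module.Finite R X)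

lemma isFG_of_mono [IsNoetherianRing R] {X Y : ModuleCat.{u} R} (f : X ⟶ Y) [Mono f]
    (hY : isFG R Y) : isFG R X :=
  have : Module.Finite R Y := hY
  Module.Finite.of_injective f.hom ((mono_iff_injective f).1 inferInstance)

lemma isFG_of_exact [IsNoetherianRing R] {T : ShortComplex (ModuleCat.{u} R)} (hT : T.Exact)
    (h₁ : isFG R T.X₁) (h₃ : isFG R T.X₃) : isFG R T.X₂ := by
  have : Module.Finite R T.X₁ := h₁
  have : Module.Finite R T.X₃ := h₃
  have := isNoetherian_of_range_eq_ker T.f.hom T.g.hom hT.moduleCat_range_eq_ker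
  exact inferInstanceAs (Module.Finite R T.X₂)

/-- A faithful functor preserving monomorphisms reflects finite generation over Noetherian
rings, because it embeds lattices of submodules. -/
lemma isFG_of_faithful [IsNoetherianRing R] (Φ : ModuleCat.{u} S ⥤ ModuleCat.{u} R)
    [Φ.Faithful] [Φ.PreservesMonomorphisms] {X : ModuleCat.{u} S} (hX : isFG R (Φ.obj X)) :
    isFG S X := by
  have : Module.Finite R (Φ.obj X) := hX
  let ψ (N : Submodule S X) : Submodule R (Φ.obj X) :=
    LinearMap.range (Φ.map (ofHom N.subtype)).hom
  have hcomp {N₁ N₂ : Submodule S X} (h : N₁ ≤ N₂) :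
      Φ.map (ofHom (Submodule.inclusion h)) ≫ Φ.map (ofHom N₂.subtype) =
        Φ.map (ofHom N₁.subtype) := (Φ.map_comp _ _).symm
  have hψ : StrictMono ψ := by
    refine fun N₁ N₂ h ↦ lt_of_le_not_ge ?_ fun h' ↦ h.not_ge ?_
    · rintro _ ⟨x, rfl⟩
      exact ⟨(Φ.map (ofHom (Submodule.inclusion h.le))).hom x,
        congrArg (fun f ↦ f.hom x) (hcomp h.le)⟩
    -- If the images coincided, `Φ` would send the inclusion to an epimorphism, which faithfulness
    -- reflects.
    · have : Epi (Φ.map (ofHom (Submodule.inclusion h.le))) := by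
        refine (epi_iff_surjective _).2 fun y ↦ ?_
        obtain ⟨x, hx⟩ := h' ⟨y, rfl⟩
        refine ⟨x, (mono_iff_injective (Φ.map (ofHom N₂.subtype))).1 inferInstance ?_⟩
        exact (congrArg (fun f ↦ f.hom x) (hcomp h.le)).trans hx
      have := (epi_iff_surjective _).1 (Φ.epi_of_epi_map this)
      intro y hy
      obtain ⟨x, hx⟩ := this ⟨y, hy⟩
      have : (x : X) = y := congrArg Subtype.val hx
      exact this ▸ x.2
  have : IsNoetherian S X := isNoetherian_iff'.2 hψ.wellFoundedGT
  exact inferInstanceAs (Module.Finite S X)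

end ModuleCat

lemma LinearMap.exists_fg_map_eq_top {R M N : Type*} [Ring R] [AddCommGroup M] [AddCommGroup N]
    [Module R M] [Module R N] [Module.Finite R N] (f : M →ₗ[R] N)
    (hf : Function.Surjective f) : ∃ P : Submodule R M, P.FG ∧ P.map f = ⊤ := by
  classical
  obtain ⟨s, hs⟩ := Module.Finite.fg_top (R := R) (M := N)
  refine ⟨Submodule.span R (s.image (Function.surjInv hf)), ⟨_, rfl⟩, ?_⟩
  rw [Submodule.map_span, Finset.coe_image, ← Set.image_comp, ← hs,
    Function.RightInverse.id (Function.rightInverse_surjInv hf), Set.image_id]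

/-! ### The functors of a nilpotent cleft extension preserve finite generation. -/

namespace CleftExtension

open ModuleCat

variable {R S : Type u} [Ring R] [Ring S]
  (c : CleftExtension (ModuleCat.{u} S) (ModuleCat.{u} R))

/-- The functor `l` preserves finite generation as soon as it does so on the regular module. -/
lemma isFG_l_of_isFG_self (h : isFG R (c.l.obj (of S S))) (X : ModuleCat.{u} S)
    (hX : isFG S X) : isFG R (c.l.obj X) := by
  have : Module.Finite S X := hX
  have : Module.Finite R (c.l.obj (of S S)) := h
  obtain ⟨s, hs⟩ := Module.Finite.fg_top (R := S) (M := X)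
  let g (x : X) : of S S ⟶ X := ofHom (LinearMap.toSpanSingleton S X x)
  let N : Submodule R (c.l.obj X) := ⨆ x : s, LinearMap.range (c.l.map (g x)).hom
  have hN : N.FG := Submodule.fg_iSup _ fun x ↦ by
    rw [LinearMap.range_eq_map]
    exact Module.Finite.fg_top.map _
  let q : c.l.obj X ⟶ of R (c.l.obj X ⧸ N) := ofHom N.mkQ
  have hgq (x : X) (hx : x ∈ s) : c.l.map (g x) ≫ q = 0 := by
    ext y
    exact (Submodule.Quotient.mk_eq_zero N).2 (le_iSup
      (fun x : s ↦ LinearMap.range (c.l.map (g x)).hom) ⟨x, hx⟩ ⟨y, rfl⟩)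
  -- The adjoint of `q` vanishes on the generators of `X`, hence is zero.
  have hq' : c.η X ≫ c.e.map q = 0 := by
    ext1
    refine LinearMap.ext_on hs fun x hx ↦ ?_
    have h : g x ≫ c.η X ≫ c.e.map q = 0 := by
      rw [← Category.assoc, c.η_naturality, Category.assoc, ← c.e.map_comp, hgq x hx,
        c.e.map_zero, comp_zero]
    have h' := congrArg (fun f ↦ f.hom (1 : S)) h
    have h1 : (g x).hom (1 : S) = x := one_smul S x
    exact (congrArg (c.η X ≫ c.e.map q).hom h1).symm.trans h'
  have hq : q = 0 := (c.adj.homEquiv _ _).injective (by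
    rw [Adjunction.homEquiv_unit, Adjunction.homEquiv_unit]
    exact hq'.trans (by simp))
  have : N = ⊤ := by
    rw [eq_top_iff]
    intro x _
    exact (Submodule.Quotient.mk_eq_zero N).1 (congrArg (fun f ↦ f.hom x) hq)
  exact ⟨this ▸ hN⟩

/-- Choose a finitely generated `P` in `l X` mapping onto `i X`. The kernel of `l X ⟶ i X`, which is
`G (i X)`, then surjects onto `l X ⧸ P`, so `γ` is epi on this quotient and nilpotence kills it. -/
lemma isFG_l_of_isFG_i {n : ℕ} (hnil : ∀ X, IsZero ((endofunctorPow c.F n).obj X))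
    (X : ModuleCat.{u} S) (hX : isFG R (c.i.obj X)) : isFG R (c.l.obj X) := by
  have : Module.Finite R (c.i.obj X) := hX
  let p : c.l.obj X ⟶ c.i.obj X := c.l.map (c.isoApp X).inv ≫ c.adj.counit.app (c.i.obj X)
  have hp : Function.Surjective p.hom := (ModuleCat.epi_iff_surjective p).1 (epi_comp _ _)
  obtain ⟨P, hP, hPp⟩ := LinearMap.exists_fg_map_eq_top p.hom hp
  let q : c.l.obj X ⟶ of R (c.l.obj X ⧸ P) := ofHom P.mkQ
  have hq : Epi (c.Gι (c.i.obj X) ≫ c.l.map (c.isoApp X).hom ≫ q) := by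
    refine (ModuleCat.epi_iff_surjective _).2 fun y ↦ ?_
    obtain ⟨x, rfl⟩ := P.mkQ_surjective y
    obtain ⟨m, hm, hmx⟩ : p.hom x ∈ P.map p.hom := hPp ▸ Submodule.mem_top
    let a : c.l.obj (c.e.obj (c.i.obj X)) := (c.l.map (c.isoApp X).inv).hom (x - m)
    have ha : (c.adj.counit.app (c.i.obj X)).hom a = 0 := by
      have : p.hom (x - m) = 0 := by rw [map_sub, hmx, sub_self]
      exact this
    have ha' : (c.l.map (c.isoApp X).hom).hom a = x - m := by
      have : c.l.map (c.isoApp X).inv ≫ c.l.map (c.isoApp X).hom = 𝟙 _ := by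
        rw [← c.l.map_comp, Iso.inv_hom_id, CategoryTheory.Functor.map_id]
      exact congrArg (fun f ↦ f.hom (x - m)) this
    obtain ⟨b, hb⟩ := (ShortComplex.moduleCat_exact_iff _).1
      (c.shortExact_counit (c.i.obj X)).exact a ha
    refine ⟨b, ?_⟩
    have h : q.hom ((c.l.map (c.isoApp X).hom).hom ((c.Gι (c.i.obj X)).hom b)) = P.mkQ x := by
      have hb' : (c.Gι (c.i.obj X)).hom b = a := hb
      rw [hb', ha']
      refine (Submodule.Quotient.eq P).2 ?_
      simpa using hm
    exact h
  have := c.epi_γ_of_epi q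
  have hz := ModuleCat.subsingleton_of_isZero (c.isZero_of_epi_γ hnil (of R (c.l.obj X ⧸ P)))
  have : P = ⊤ := Submodule.Quotient.subsingleton_iff.1 hz
  exact ⟨this ▸ hP⟩

variable [IsNoetherianRing S]

lemma isFG_i (X : ModuleCat.{u} S) (hX : isFG S X) : isFG R (c.i.obj X) :=
  isFG_of_faithful c.e (isFG_of_iso (c.isoApp X).symm hX)

variable [IsNoetherianRing R]

/-- On the cokernel `W` of `γ Y` the map `γ` vanishes, so `W ≅ i (e W)` and `e W` is finitely
generated because `i` reflects this. On the image of `γ Y`, `e` gives a quotient of `F (e Y)`, which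
is killed by a smaller power of `F`. Noetherianity makes the image finitely generated, so induction
applies. -/
lemma isFG_e (k : ℕ) (Y : ModuleCat.{u} R) (hY : isFG R Y)
    (hk : IsZero ((endofunctorPow c.F k).obj (c.e.obj Y))) : isFG S (c.e.obj Y) := by
  induction k generalizing Y with
  | zero => exact isFG_of_isZero hk
  | succ k ih =>
    have hk' : IsZero ((endofunctorPow c.F k).obj (c.F.obj (c.e.obj Y))) :=
      hk.of_iso ((endofunctorPowSuccIso c.F k).app (c.e.obj Y)).symm
    let W := cokernel (c.γ Y)
    let π : Y ⟶ W := cokernel.π (c.γ Y)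
    have hW : c.γ W = 0 := by
      have := c.epi_G_map_i_map (c.e.map π)
      rw [← cancel_epi (c.G.map (c.i.map (c.e.map π))), γ_naturality, comp_zero]
      exact cokernel.condition _
    obtain ⟨e⟩ := c.nonempty_iso_of_γ_eq_zero hW
    have h₃ : isFG S (c.e.obj W) :=
      isFG_of_faithful c.i (isFG_of_iso e.symm (isFG_of_epi π hY))
    have h₁ : isFG S (c.e.obj (Abelian.image (c.γ Y))) := by
      refine ih _ (isFG_of_mono (Abelian.image.ι (c.γ Y)) hY) ?_
      let f : c.F.obj (c.e.obj Y) ⟶ c.e.obj (Abelian.image (c.γ Y)) :=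
        c.e.map (Abelian.factorThruImage (c.γ Y))
      have : Epi f := inferInstanceAs (Epi (c.e.map (Abelian.factorThruImage (c.γ Y))))
      have := endofunctorPow_preservesFiniteColimits c.F k
      exact hk'.of_epi ((endofunctorPow c.F k).map f)
    have hT : (ShortComplex.mk (Abelian.image.ι (c.γ Y)) π (kernel.condition _)).Exact :=
      ShortComplex.exact_of_f_is_kernel _ (kernelIsKernel _)
    exact isFG_of_exact (hT.map c.e) h₁ h₃

lemma preservesFG {n : ℕ} (hnil : ∀ X, IsZero ((endofunctorPow c.F n).obj X)) :
    c.PreservesFG where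
  i := c.isFG_i
  e Y hY := c.isFG_e n Y hY (hnil _)
  l := c.isFG_l_of_isFG_self (c.isFG_l_of_isFG_i hnil _ (c.isFG_i _
    (inferInstanceAs (Module.Finite S S))))

end CleftExtension

/-! ### Projective finitely generated modules, and the theorem. -/

namespace FGModuleCat

variable {R : Type u} [Ring R]

lemma exists_epi_of_free (X : FGModuleCat.{u} R) :
    ∃ (P : FGModuleCat.{u} R) (f : P ⟶ X), Epi f ∧ Projective P.obj := by
  obtain ⟨n, f, hf⟩ := Module.Finite.exists_fin' R X
  let g : of R (Fin n → R) ⟶ X := ObjectProperty.homMk (ModuleCat.ofHom f)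
  refine ⟨_, g, (ModuleCat.isFG R).ι.epi_of_epi_map ((ModuleCat.epi_iff_surjective _).2 hf), ?_⟩
  exact ModuleCat.projective_of_free (Pi.basisFun R (Fin n))

/-- A projective object of the small category is a retract of a free module of finite rank. -/
lemma projective_ι (X : FGModuleCat.{u} R) (hX : Projective X) : Projective ((ι R).obj X) := by
  obtain ⟨P, f, _, _⟩ := exists_epi_of_free X
  let r : Retract X P := ⟨Projective.factorThru (𝟙 X) f, f, Projective.factorThru_comp _ _⟩
  have : Projective ((ι R).obj P) := ‹_›
  exact (r.map (ι R)).projective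

variable [IsNoetherianRing R]

lemma projective_of_projective_ι (P : FGModuleCat.{u} R) [Projective P.obj] :
    Projective P where
  factors f e _ :=
    have : Projective ((ι R).obj P) := ‹_›
    ⟨ObjectProperty.homMk (Projective.factorThru ((ι R).map f) ((ι R).map e)),
      (ι R).map_injective (Projective.factorThru_comp ((ι R).map f) ((ι R).map e))⟩

instance : EnoughProjectives (FGModuleCat.{u} R) where
  presentation X := by
    obtain ⟨P, f, _, _⟩ := exists_epi_of_free X
    exact ⟨{ p := P, f := f, projective := projective_of_projective_ι P }⟩

end FGModuleCat

theorem mainTheorem3 {A B : Type u} [Ring A] [Ring B]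
    [IsNoetherianAlgebra A] [IsNoetherianAlgebra B]
    [HasDerivedCategory.{w₁} (FGRightModCat A)] [HasDerivedCategory.{w₂} (FGRightModCat B)]
    (c : CleftExtension (RightModCat B) (RightModCat A))
    (hperf : IsLeftPerfect c.F)
    (n : ℕ) (hn : 0 < n) (hnil : ∀ X : RightModCat B, IsZero ((endofunctorPow c.F n).obj X)) :
    rouquierDim (DerivedCategory.Bounded (FGRightModCat B)) ≤
        rouquierDim (DerivedCategory.Bounded (FGRightModCat A)) ∧
      rouquierDim (DerivedCategory.Bounded (FGRightModCat A)) ≤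
        (n : ℕ∞) * (rouquierDim (DerivedCategory.Bounded (FGRightModCat B)) + 1) - 1 := by
  have hc := c.preservesFG hnil
  refine hc.restrict.rouquierDim_bounded_le
    (hperf.of_faithful (FGModuleCat.ι _) FGModuleCat.projective_ι hc.restrictFIso) n hn fun X ↦ ?_
  have h : IsZero ((FGModuleCat.ι _).obj ((endofunctorPow hc.restrict.F n).obj X)) :=
    (hnil X.obj).of_iso ((endofunctorPowCompIso _ hc.restrictFIso n).app X)
  rw [IsZero.iff_id_eq_zero]
  exact (FGModuleCat.ι _).map_injective (h.eq_of_src _ _)
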